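/- Let $\mu$ be a probability measure on $\partial\mathbb D=\{|z|=1\}$ that is nontrivial (not supported on a finite set), with monic orthogonal polynomials $\Phi_n$ and Verblunsky coefficients $\alpha_n=-\overline{\Phi_{n+1}(0)}$, and put $\rho_n=(1-|\alpha_n|^2)^{1/2}$. Let $F(z)=\int\frac{e^{i\theta}+z}{e^{i\theta}-z}\,d\mu(\theta)$ be its Carathéodory function and $f$ its Schur function, the analytic function on $\mathbb D=\{|z|<1\}$ determined by $F(z)=\frac{1+zf(z)}{1-zf(z)}$. Write $d\mu=w\,\frac{d\theta}{2\pi}+d\mu_{\rm s}$ with $\mu_{\rm s}$ singular with respect to $d\theta$. **(a)** Let $\mu_1$ be a nontrivial probability measure on $\partial\mathbb D$ with Verblunsky coefficients $\alpha_1,\alpha_2,\dots$, with Schur function $f_1$ and weight $w_1$, where $d\mu_1=w_1\frac{d\theta}{2\pi}+d\mu_{1,{\rm s}}$, and let $$(\delta_0D)(z)=\frac{1-\bar\alpha_0 f(z)}{\rho_0}\;\frac{1-zf_1(z)}{1-zf(z)} .$$ If $w(\theta)\ne0$ for a.e. $\theta$, then $w_1(\theta)\neq 0$ for a.e. $\theta$,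 $\log(w/w_1)$ is integrable, $\delta_0D$ is the outer function $$(\delta_0D)(z)=\exp\Bigl(\int_0^{2\pi}\frac{e^{i\theta}+z}{e^{i\theta}-z}\,\log\Bigl(\frac{w(\theta)}{w_1(\theta)}\Bigr)\frac{d\theta}{4\pi}\Bigr),\qquad |z|<1,$$ and $$\rho_0^2=\exp\Bigl(\int_0^{2\pi}\log\Bigl(\frac{w(\theta)}{w_1(\theta)}\Bigr)\frac{d\theta}{2\pi}\Bigr).$$ **(b)** Let $\mu_0=\mu$, and for each $n\ge1$ let $\mu_n$ be a nontrivial probability measure on $\partial\mathbb D$ with Verblunsky coefficients $\alpha_n,\alpha_{n+1},\dots$ and with weight $w_n$. If $w(\theta)\neq 0$ for a.e. $\theta$, then for every $n\ge 0$, $w_n(\theta)\ne0$ for a.e. $\theta$, $\log(w/w_n)$ is integrable, and $$(\rho_0\cdots\rho_{n-1})^2=\exp\Bigl(\int_0^{2\pi}\log\Bigl(\frac{w(\theta)}{w_n(\theta)}\Bigr)\frac{d\theta}{2\pi}\Bigr).$$ **(c)** (Szegő's theorem.) Without any assumption on $w$, $$\prod_{j=0}^\infty(1-|\alpha_j|^2)=\exp\Bigl(\int_0^{2\pi}\log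 w(\theta)\,\frac{d\theta}{2\pi}\Bigr),$$ where the integral on the right may be $-\infty$ (in which case the right side is $0$). -/

import Mathlib

open MeasureTheory Filter Topology
open scoped ComplexConjugate ENNReal Polynomial

noncomputable section

namespace OPUC

/-- The Borel σ-algebra on the unit circle. -/
instance instMeasurableSpaceCircle : MeasurableSpace Circle := borel Circle

instance instBorelSpaceCircle : BorelSpace Circle := ⟨rfl⟩

/-- Normalized arc length `dθ/2π` on the unit circle. -/
def arc : Measure Circle :=
  ENNReal.ofReal (2 * Real.pi)⁻¹ •
    (volume.restrict (Set.Ioc (0 : ℝ) (2 * Real.pi))).map Circle.exp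

/-- A measure on the circle is nontrivial if it is not supported on a finite set. -/
def IsNontrivial (μ : Measure Circle) : Prop :=
  ∀ s : Set Circle, s.Finite → μ sᶜ ≠ 0

/-- The inner product of two polynomials in `L²(μ)`, conjugate-linear in the first argument. -/
def polyInner (μ : Measure Circle) (P Q : ℂ[X]) : ℂ :=
  ∫ ζ : Circle, conj (P.eval (ζ : ℂ)) * Q.eval (ζ : ℂ) ∂μ

/-- The monic orthogonal polynomials `Φ_n` of `μ`, by the Gram-Schmidt procedure applied to
`1, z, z², …` in `L²(μ)` (without normalization). -/
def monicOP (μ : Measure Circle) (n : ℕ) : ℂ[X] :=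
  Polynomial.X ^ n - ∑ k : Fin n,
    Polynomial.C (polyInner μ (monicOP μ k) (Polynomial.X ^ n) /
      polyInner μ (monicOP μ k) (monicOP μ k)) * monicOP μ k
termination_by n
decreasing_by all_goals exact k.2

/-- The Verblunsky coefficients `α_n`: the Szegő recursion
`Φ_{n+1}(z) = z Φ_n(z) - conj α_n Φ_n^*(z)` with `Φ_n^*(0) = 1` gives `Φ_{n+1}(0) = - conj α_n`. -/
def verblunsky (μ : Measure Circle) (n : ℕ) : ℂ :=
  -conj ((monicOP μ (n + 1)).eval 0)

/-- `ρ_n = (1 - |α_n|²)^{1/2}`. -/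
def rho (μ : Measure Circle) (n : ℕ) : ℝ :=
  Real.sqrt (1 - ‖verblunsky μ n‖ ^ 2)

/-- The Carathéodory function `F(z) = ∫ (e^{iθ} + z) / (e^{iθ} - z) dμ(θ)`. -/
def caratheodory (μ : Measure Circle) (z : ℂ) : ℂ :=
  ∫ ζ : Circle, ((ζ : ℂ) + z) / ((ζ : ℂ) - z) ∂μ

/-- The Schur function `f`, determined by `F = (1 + z f) / (1 - z f)`, that is by
`z f = (F - 1) / (F + 1)`. The right side vanishes at `0` as `F(0) = 1` for a probability measure;
`dslope` divides by `z` and takes the value of the derivative at the removable singularity. -/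
def schur (μ : Measure Circle) : ℂ → ℂ :=
  dslope (fun z => (caratheodory μ z - 1) / (caratheodory μ z + 1)) 0

/-- The relative Szegő function
`(δ₀D)(z) = (1 - conj α₀ f(z)) / ρ₀ * (1 - z f₁(z)) / (1 - z f(z))`, where `α₀`, `ρ₀`, `f` belong to
`μ`, and `f₁` is the Schur function of the measure `μ₁` whose Verblunsky coefficients are
`α₁, α₂, …`. -/
def relSzego (μ μ₁ : Measure Circle) (z : ℂ) : ℂ :=
  (1 - conj (verblunsky μ 0) * schur μ z) / (rho μ 0 : ℂ) *
    ((1 - z * schur μ₁ z) / (1 - z * schur μ z))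

/-- The weight `w` of `μ = w dθ/2π + μ_s` (Lebesgue decomposition). -/
def weight (μ : Measure Circle) (ζ : Circle) : ℝ :=
  (μ.rnDeriv arc ζ).toReal

/-- The integral `∫ log w dθ/2π` with values in `[-∞, ∞]` (and `log 0 = -∞`), for the
weight `w` of `μ`: integral of the positive part minus integral of the negative part. The integral
of the positive part is finite when `μ` is, as `log⁺ w ≤ w`. -/
def logIntegral (μ : Measure Circle) : EReal :=
  ((∫⁻ ζ, (ENNReal.log (μ.rnDeriv arc ζ)).toENNReal ∂arc : ℝ≥0∞) : EReal) -
    ((∫⁻ ζ, (-ENNReal.log (μ.rnDeriv arc ζ)).toENNReal ∂arc : ℝ≥0∞) : EReal)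

end OPUC

end

noncomputable section

namespace OPUC

/-! The sum rule comes from an exact identity inside the disc. Write `F`, `f`, `w` for the data of
`μ` and `F₁`, `f₁`, `w₁` for those of `μ₁`. The Schur algorithm `f - α₀ = z f₁ (1 - conj α₀ f)`
(`schur_step`) gives `|δ₀D|² Re F₁ = Re F - (1 - |z|²) |f|² / |1 - z f|²` (`norm_relSzego_sq_mul`).
Along radii tending to one, `Re F` and `Re F₁`, being Poisson integrals, tend in measure to `w` and
`w₁` (`tendstoInMeasure_integral_poisson`), and the last term vanishes along a subsequence because
`log (1 - z f)` has finite boundary values. Hence `|δ₀D|² w₁ = w` a.e. on the circle. Moreover `δ₀D`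
is, up to the constant `ρ₀`, a product and quotient of functions with positive real part, so it has
a logarithm with bounded imaginary part. Such a logarithm lies in `H²` and is the Schwarz integral
of its boundary real part (`exists_boundary_values`), which is `log (w / w₁) / 2` when `w ≠ 0` a.e.
This is outerness; the value at `0`, where `f(0) = α₀`, is the formula for `ρ₀`. Iteration
telescopes.

The Schur algorithm itself (Geronimus) is derived from the transforms `transU` and `transV`, which
satisfy the Szegő recursion. A determinant comparing those of `μ`, shifted by one index, with those
of `μ₁` is multiplied at each step by `z ρ²`, whereas orthogonality makes it smaller by a further
factor `|z|ⁿ`; so it is zero (`caratheodory_step`).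

Szegő's theorem is proved separately, by a variational argument. The partial products are `‖Φ_n‖²`,
and they decrease to the infimum `L` of `‖Q‖²` over polynomials with `Q(0) = 1`. Jensen's
inequality, with Mahler measure at least one for monic polynomials, gives `exp ∫ log w ≤ ‖Φ_n‖²`
(`exp_logIntegral_le_normSq`). Conversely, testing `L` on Taylor polynomials of `e^G` with `G(0) =
0`, then approximating, gives `L exp (∫ g dθ/2π) ≤ ∫ e^g dμ` for all bounded measurable `g`. Taking
`g` near `-log w` off a null set carrying the singular part, and very negative on that set, yields
`L ≤ exp ∫ log w` (`ofReal_le_exp_logIntegral`). -/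

/-! ### Integration on the circle -/

theorem continuous_circleExp : Continuous (fun θ : ℝ => Circle.exp θ) := Circle.exp.continuous

theorem continuous_coe : Continuous fun ζ : Circle => (ζ : ℂ) := continuous_subtype_val

theorem continuous_conj_coe : Continuous fun ζ : Circle => conj (ζ : ℂ) :=
  Complex.continuous_conj.comp continuous_coe

theorem lintegral_arc {f : Circle → ℝ≥0∞} (hf : Measurable f) :
    ∫⁻ ζ, f ζ ∂arc =
      ENNReal.ofReal (2 * Real.pi)⁻¹ * ∫⁻ θ in Set.Ioc 0 (2 * Real.pi), f (Circle.exp θ) := by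
  rw [arc, lintegral_smul_measure, lintegral_map hf continuous_circleExp.measurable, smul_eq_mul]

instance isProbabilityMeasure_arc : IsProbabilityMeasure arc := by
  constructor
  have := lintegral_arc (f := fun _ => 1) measurable_const
  rw [lintegral_one] at this
  rw [this]
  simp only [lintegral_const, one_mul, Measure.restrict_apply MeasurableSet.univ, Set.univ_inter,
    Real.volume_Ioc, sub_zero]
  rw [← ENNReal.ofReal_mul (by positivity), inv_mul_cancel₀ (by positivity), ENNReal.ofReal_one]

theorem integral_arc {E : Type*} [NormedAddCommGroup E] [NormedSpace ℝ E] {f : Circle → E}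
    (hf : StronglyMeasurable f) :
    ∫ ζ, f ζ ∂arc = (2 * Real.pi)⁻¹ • ∫ θ in (0 : ℝ)..2 * Real.pi, f (Circle.exp θ) := by
  rw [arc, integral_smul_measure, integral_map continuous_circleExp.measurable.aemeasurable
    hf.aestronglyMeasurable, intervalIntegral.integral_of_le (by positivity),
    ENNReal.toReal_ofReal (by positivity)]

theorem integral_arc_eq_circleAverage {E : Type*} [NormedAddCommGroup E] [NormedSpace ℝ E]
    {g : ℂ → E} {r : ℝ} (hg : StronglyMeasurable fun ζ : Circle => g (r * ζ)) :
    ∫ ζ : Circle, g (r * ζ) ∂arc = Real.circleAverage g 0 r := by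
  rw [integral_arc hg, Real.circleAverage_def]
  simp [circleMap, Circle.coe_exp]

theorem integrable_arc_iff {E : Type*} [NormedAddCommGroup E] {f : Circle → E}
    (hf : StronglyMeasurable f) :
    Integrable f arc ↔
      IntervalIntegrable (fun θ => f (Circle.exp θ)) volume 0 (2 * Real.pi) := by
  rw [arc, integrable_smul_measure (by positivity) (by simp),
    integrable_map_measure hf.aestronglyMeasurable continuous_circleExp.measurable.aemeasurable,
    intervalIntegrable_iff_integrableOn_Ioc_of_le (by positivity)]
  rfl

theorem integrable_of_continuous {E : Type*} [NormedAddCommGroup E]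
    {μ : Measure Circle} [IsFiniteMeasure μ] {f : Circle → E} (hf : Continuous f) :
    Integrable f μ := by
  exact hf.integrable_of_hasCompactSupport (HasCompactSupport.of_compactSpace f)

theorem memLp_of_continuous {E : Type*} [NormedAddCommGroup E] {p : ℝ≥0∞}
    {μ : Measure Circle} [IsFiniteMeasure μ] {f : Circle → E} (hf : Continuous f) :
    MemLp f p μ :=
  hf.memLp_of_hasCompactSupport (HasCompactSupport.of_compactSpace f)

theorem one_sub_norm_le_norm_sub (ζ : Circle) (z : ℂ) : 1 - ‖z‖ ≤ ‖(ζ : ℂ) - z‖ := by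
  have := norm_sub_norm_le (ζ : ℂ) z
  rwa [Circle.norm_coe] at this

theorem coe_sub_ne_zero (ζ : Circle) {z : ℂ} (hz : ‖z‖ < 1) : (ζ : ℂ) - z ≠ 0 :=
  norm_pos_iff.1 ((sub_pos.2 hz).trans_le (one_sub_norm_le_norm_sub ζ z))

theorem conj_coe_mul_coe (ζ : Circle) : conj (ζ : ℂ) * ζ = 1 := by
  rw [← Complex.normSq_eq_conj_mul_self]; simp

theorem continuous_eval (P : ℂ[X]) : Continuous fun ζ : Circle => P.eval (ζ : ℂ) :=
  P.continuous.comp continuous_coe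

theorem continuous_conj_eval_mul (P Q : ℂ[X]) :
    Continuous fun ζ : Circle => conj (P.eval (ζ : ℂ)) * Q.eval (ζ : ℂ) :=
  (Complex.continuous_conj.comp (continuous_eval P)).mul (continuous_eval Q)

/-! ### Polynomials in `L²(μ)` -/

/-- The squared `L²(μ)` norm of a polynomial. -/
def normSq (μ : Measure Circle) (P : ℂ[X]) : ℝ := ∫ ζ : Circle, ‖P.eval (ζ : ℂ)‖ ^ 2 ∂μ

section

variable (μ : Measure Circle)

theorem polyInner_self (P : ℂ[X]) : polyInner μ P P = normSq μ P := by
  rw [polyInner, normSq, ← integral_complex_ofReal]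
  congr 1; ext ζ
  rw [← Complex.normSq_eq_conj_mul_self, Complex.normSq_eq_norm_sq]

theorem normSq_nonneg (P : ℂ[X]) : 0 ≤ normSq μ P := integral_nonneg fun _ => by positivity

theorem conj_polyInner (P Q : ℂ[X]) : conj (polyInner μ P Q) = polyInner μ Q P := by
  rw [polyInner, polyInner, ← integral_conj]
  congr 1; ext ζ
  simp [mul_comm]

theorem polyInner_X_mul (P Q : ℂ[X]) :
    polyInner μ (Polynomial.X * P) (Polynomial.X * Q) = polyInner μ P Q := by
  rw [polyInner, polyInner]
  congr 1; ext ζ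
  simp only [Polynomial.eval_mul, Polynomial.eval_X, map_mul]
  linear_combination (conj (P.eval (ζ : ℂ)) * Q.eval (ζ : ℂ)) * conj_coe_mul_coe ζ

theorem polyInner_C_mul_right (P Q : ℂ[X]) (c : ℂ) :
    polyInner μ P (Polynomial.C c * Q) = c * polyInner μ P Q := by
  rw [polyInner, polyInner, ← integral_const_mul]
  congr 1; ext ζ
  simp only [Polynomial.eval_mul, Polynomial.eval_C]; ring

theorem polyInner_eq_zero_comm {P Q : ℂ[X]} (h : polyInner μ P Q = 0) : polyInner μ Q P = 0 := by
  rw [← conj_polyInner, h, map_zero]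

theorem normSq_C_mul (c : ℂ) (P : ℂ[X]) :
    normSq μ (Polynomial.C c * P) = ‖c‖ ^ 2 * normSq μ P := by
  rw [normSq, normSq, ← integral_const_mul]
  congr 1; ext ζ
  simp only [Polynomial.eval_mul, Polynomial.eval_C, norm_mul]; ring

theorem normSq_X_mul (P : ℂ[X]) : normSq μ (Polynomial.X * P) = normSq μ P := by
  simp [normSq, Circle.norm_coe]

variable [IsFiniteMeasure μ]

theorem polyInner_add_right (P Q R : ℂ[X]) :
    polyInner μ P (Q + R) = polyInner μ P Q + polyInner μ P R := by
  rw [polyInner, polyInner, polyInner, ← integral_add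
    (integrable_of_continuous (continuous_conj_eval_mul P Q))
    (integrable_of_continuous (continuous_conj_eval_mul P R))]
  congr 1; ext ζ
  simp only [Polynomial.eval_add]; ring

/-- The inner product as a linear map in its second argument. -/
def innerₗ (P : ℂ[X]) : ℂ[X] →ₗ[ℂ] ℂ where
  toFun := polyInner μ P
  map_add' := polyInner_add_right μ P
  map_smul' c Q := by
    rw [Polynomial.smul_eq_C_mul, polyInner_C_mul_right]; rfl

theorem polyInner_sub_right (P Q R : ℂ[X]) :
    polyInner μ P (Q - R) = polyInner μ P Q - polyInner μ P R :=
  map_sub (innerₗ μ P) Q R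

theorem polyInner_sum_right {ι : Type*} (s : Finset ι) (P : ℂ[X]) (Q : ι → ℂ[X]) :
    polyInner μ P (∑ i ∈ s, Q i) = ∑ i ∈ s, polyInner μ P (Q i) :=
  map_sum (innerₗ μ P) Q s

theorem normSq_add {P Q : ℂ[X]} (h : polyInner μ P Q = 0) :
    normSq μ (P + Q) = normSq μ P + normSq μ Q := by
  have h' := polyInner_eq_zero_comm μ h
  apply Complex.ofReal_injective
  push_cast
  rw [← polyInner_self, ← polyInner_self, ← polyInner_self, polyInner_add_right,
    ← conj_polyInner, ← conj_polyInner μ Q, polyInner_add_right, polyInner_add_right, h, h',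
    add_zero, zero_add, conj_polyInner, conj_polyInner]

variable {μ}

/-- Otherwise `μ` would be carried by the finitely many zeros of `P`. This is how nontriviality
enters the algebra. -/
theorem eq_zero_of_normSq_eq_zero (hμ : IsNontrivial μ) {P : ℂ[X]} (h : normSq μ P = 0) :
    P = 0 := by
  by_contra hP
  have hc : Continuous fun ζ : Circle => ‖P.eval (ζ : ℂ)‖ ^ 2 := (continuous_eval P).norm.pow 2
  rw [normSq, integral_eq_zero_iff_of_nonneg (fun _ => by positivity)
    (integrable_of_continuous hc)] at h
  refine hμ {ζ : Circle | P.eval (ζ : ℂ) = 0} ?_ ?_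
  · have : {ζ : Circle | P.eval (ζ : ℂ) = 0} = (fun ζ : Circle => (ζ : ℂ)) ⁻¹' (P.rootSet ℂ) := by
      ext ζ
      simp [Polynomial.mem_rootSet, hP]
    rw [this]
    exact (P.rootSet_finite ℂ).preimage Circle.coe_injective.injOn
  · refine measure_mono_null (fun ζ hζ => ?_) h
    simpa using hζ

theorem normSq_pos (hμ : IsNontrivial μ) {P : ℂ[X]} (hP : P ≠ 0) : 0 < normSq μ P :=
  (normSq_nonneg μ P).lt_of_ne fun h => hP (eq_zero_of_normSq_eq_zero hμ h.symm)

end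

/-! ### Monic orthogonal polynomials -/

section

variable (μ : Measure Circle)

theorem monicOP_eq (n : ℕ) : monicOP μ n = Polynomial.X ^ n - ∑ k ∈ Finset.range n,
    Polynomial.C (polyInner μ (monicOP μ k) (Polynomial.X ^ n) /
      polyInner μ (monicOP μ k) (monicOP μ k)) * monicOP μ k := by
  rw [monicOP, Finset.sum_range]

theorem monicOP_zero : monicOP μ 0 = 1 := by
  rw [monicOP_eq]; simp

theorem monicOP_monic_and_natDegree (n : ℕ) :
    (monicOP μ n).Monic ∧ (monicOP μ n).natDegree = n := by
  induction n using Nat.strong_induction_on with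
  | _ n ih =>
    have hlt : (∑ k ∈ Finset.range n,
        Polynomial.C (polyInner μ (monicOP μ k) (Polynomial.X ^ n) /
          polyInner μ (monicOP μ k) (monicOP μ k)) * monicOP μ k).degree <
        (Polynomial.X ^ n : ℂ[X]).degree := by
      rw [Polynomial.degree_X_pow]
      refine (Polynomial.degree_sum_le _ _).trans_lt ?_
      rw [Finset.sup_lt_iff (by simp)]
      intro k hk
      have hk' := Finset.mem_range.1 hk
      rw [← Polynomial.smul_eq_C_mul]
      refine (Polynomial.degree_smul_le _ _).trans_lt ?_
      rw [Polynomial.degree_eq_natDegree (ih k hk').1.ne_zero, (ih k hk').2]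
      exact_mod_cast hk'
    rw [monicOP_eq]
    refine ⟨(Polynomial.monic_X_pow n).sub_of_left hlt, ?_⟩
    rw [Polynomial.natDegree_eq_of_degree_eq (Polynomial.degree_sub_eq_left_of_degree_lt hlt),
      Polynomial.natDegree_X_pow]

theorem monicOP_monic (n : ℕ) : (monicOP μ n).Monic := (monicOP_monic_and_natDegree μ n).1

theorem natDegree_monicOP (n : ℕ) : (monicOP μ n).natDegree = n :=
  (monicOP_monic_and_natDegree μ n).2

variable {μ} [IsFiniteMeasure μ]

theorem polyInner_monicOP_of_lt (hμ : IsNontrivial μ) (n : ℕ) :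
    ∀ k < n, polyInner μ (monicOP μ k) (monicOP μ n) = 0 := by
  induction n using Nat.strong_induction_on with
  | _ n ih =>
    intro k hk
    have hpos := normSq_pos hμ (monicOP_monic μ k).ne_zero
    rw [monicOP_eq μ n, polyInner_sub_right, polyInner_sum_right,
      Finset.sum_eq_single_of_mem k (Finset.mem_range.2 hk)]
    · rw [polyInner_C_mul_right, div_mul_cancel₀, sub_self]
      rw [polyInner_self]
      exact_mod_cast hpos.ne'
    · intro j hj hjk
      have hj' := Finset.mem_range.1 hj
      rw [polyInner_C_mul_right]
      rcases lt_or_gt_of_ne hjk with h | h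
      · rw [polyInner_eq_zero_comm μ (ih k hk j h), mul_zero]
      · rw [ih j hj' k h, mul_zero]

/-- `Φ_n` is orthogonal to all polynomials of smaller degree. -/
theorem polyInner_monicOP_of_degree_lt (hμ : IsNontrivial μ) (n : ℕ) (Q : ℂ[X])
    (hQ : Q.degree < n) : polyInner μ (monicOP μ n) Q = 0 := by
  induction hd : Q.degree using WellFoundedLT.induction generalizing Q with
  | _ d ih =>
    subst hd
    by_cases h0 : Q = 0
    · simp [h0, polyInner]
    have hdeg := Polynomial.degree_eq_natDegree h0
    set k := Q.natDegree
    have hk : k < n := by rw [hdeg] at hQ; exact_mod_cast hQ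
    -- Removing the leading term by a multiple of `Φ_k` lowers the degree without changing the inner
    -- product with `Φ_n`.
    have hsub : (Q - Polynomial.C Q.leadingCoeff * monicOP μ k).degree < Q.degree := by
      refine Polynomial.degree_sub_lt_left ?_ h0 ?_
      · rw [Polynomial.degree_C_mul (Polynomial.leadingCoeff_ne_zero.2 h0), hdeg,
          Polynomial.degree_eq_natDegree (monicOP_monic μ k).ne_zero, natDegree_monicOP]
      · rw [Polynomial.leadingCoeff_mul, Polynomial.leadingCoeff_C,
          (monicOP_monic μ k).leadingCoeff,
          mul_one]
    have h1 := ih _ hsub _ (hsub.trans hQ) rfl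
    rwa [polyInner_sub_right, polyInner_C_mul_right,
      polyInner_eq_zero_comm μ (polyInner_monicOP_of_lt hμ n k hk), mul_zero, sub_zero] at h1

end

/-! ### Reversed polynomials and the Szegő recursion -/

/-- The reversed polynomial `P^*(z) = z^n conj (P (1 / conj z))`. -/
def star (n : ℕ) (P : ℂ[X]) : ℂ[X] := (P.map (starRingEnd ℂ)).reflect n

theorem eval_star {n : ℕ} {P : ℂ[X]} (hP : P.natDegree ≤ n) (ζ : Circle) :
    (star n P).eval (ζ : ℂ) = (ζ : ℂ) ^ n * conj (P.eval (ζ : ℂ)) := by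
  let _ : Invertible (conj (ζ : ℂ)) :=
    ⟨ζ, by rw [mul_comm]; exact conj_coe_mul_coe ζ, conj_coe_mul_coe ζ⟩
  have h := Polynomial.eval₂_reflect_mul_pow (RingHom.id ℂ) (conj (ζ : ℂ)) n
    (P.map (starRingEnd ℂ)) (by rwa [Polynomial.natDegree_map])
  have h1 : ⅟(conj (ζ : ℂ)) = ζ := rfl
  have h2 : (ζ : ℂ) ^ n * conj (ζ : ℂ) ^ n = 1 := by
    rw [← mul_pow, mul_comm, conj_coe_mul_coe, one_pow]
  rw [h1, ← Polynomial.eval, ← Polynomial.eval, Polynomial.eval_map, Polynomial.eval₂_hom] at h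
  rw [← h, star, mul_left_comm, h2, mul_one]

theorem star_coeff_zero (n : ℕ) (P : ℂ[X]) : (star n P).coeff 0 = conj (P.coeff n) := by
  simp [star, Polynomial.coeff_reflect]

theorem natDegree_star_le {n : ℕ} {P : ℂ[X]} (hP : P.natDegree ≤ n) :
    (star n P).natDegree ≤ n := by
  rw [Polynomial.natDegree_le_iff_coeff_eq_zero]
  intro k hk
  rw [star, Polynomial.coeff_reflect, Polynomial.revAt_eq_self_of_lt hk, Polynomial.coeff_map,
    Polynomial.coeff_eq_zero_of_natDegree_lt (hP.trans_lt hk), map_zero]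

theorem polyInner_star_X_mul {m : ℕ} (μ : Measure Circle) {P Q : ℂ[X]}
    (hP : P.natDegree ≤ m + 1) (hQ : Q.natDegree ≤ m) :
    polyInner μ (star (m + 1) P) (Polynomial.X * Q) = polyInner μ (star m Q) P := by
  rw [polyInner, polyInner]
  congr 1; ext ζ
  rw [eval_star hP, eval_star hQ, Polynomial.eval_mul, Polynomial.eval_X]
  simp only [map_mul, map_pow, Complex.conj_conj]
  linear_combination (conj (ζ : ℂ) ^ m * P.eval (ζ : ℂ) * Q.eval (ζ : ℂ)) * conj_coe_mul_coe ζ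

theorem normSq_star {n : ℕ} (μ : Measure Circle) {P : ℂ[X]} (hP : P.natDegree ≤ n) :
    normSq μ (star n P) = normSq μ P := by
  rw [normSq, normSq]
  congr 1; ext ζ
  rw [eval_star hP]
  simp [Circle.norm_coe]

/-- The reversed orthogonal polynomials `Φ_n^*`. -/
def starOP (μ : Measure Circle) (n : ℕ) : ℂ[X] := star n (monicOP μ n)

theorem natDegree_starOP_le (μ : Measure Circle) (n : ℕ) : (starOP μ n).natDegree ≤ n :=
  natDegree_star_le (natDegree_monicOP μ n).le

theorem eval_starOP_zero (μ : Measure Circle) (n : ℕ) : (starOP μ n).eval 0 = 1 := by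
  have h : (monicOP μ n).coeff n = 1 := by
    conv_lhs => rw [← natDegree_monicOP μ n, natDegree_monicOP]
    have := monicOP_monic μ n
    rwa [Polynomial.Monic, Polynomial.leadingCoeff, natDegree_monicOP] at this
  rw [← Polynomial.coeff_zero_eq_eval_zero, starOP, star_coeff_zero, h, map_one]

theorem eval_starOP (μ : Measure Circle) (n : ℕ) (ζ : Circle) :
    (starOP μ n).eval (ζ : ℂ) = (ζ : ℂ) ^ n * conj ((monicOP μ n).eval (ζ : ℂ)) :=
  eval_star (natDegree_monicOP μ n).le ζ

theorem normSq_starOP (μ : Measure Circle) (n : ℕ) :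
    normSq μ (starOP μ n) = normSq μ (monicOP μ n) :=
  normSq_star μ (natDegree_monicOP μ n).le

/-- Separates the degenerate case `n = 0`, in which there are no powers `z, …, z^n` and `S` has to
vanish. -/
theorem natDegree_lt_or_eq_zero_of_X_mul {n : ℕ} {S : ℂ[X]}
    (h : (Polynomial.X * S).natDegree ≤ n) : S = 0 ∨ ∃ m, n = m + 1 ∧ S.natDegree ≤ m := by
  by_cases hS : S = 0
  · exact Or.inl hS
  · rw [Polynomial.natDegree_X_mul hS] at h
    exact Or.inr ⟨n - 1, by omega, by omega⟩

section

variable {μ : Measure Circle} [IsFiniteMeasure μ]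

/-- `Φ_n^*` is orthogonal to `z, …, z^n`. -/
theorem polyInner_starOP_X_mul (hμ : IsNontrivial μ) {n : ℕ} {S : ℂ[X]}
    (h : (Polynomial.X * S).natDegree ≤ n) :
    polyInner μ (starOP μ n) (Polynomial.X * S) = 0 := by
  rcases natDegree_lt_or_eq_zero_of_X_mul h with rfl | ⟨m, rfl, hm⟩
  · simp [polyInner]
  · rw [starOP, polyInner_star_X_mul μ (natDegree_monicOP μ _).le hm]
    refine polyInner_eq_zero_comm μ (polyInner_monicOP_of_degree_lt hμ _ _ ?_)
    exact Polynomial.degree_lt_iff_coeff_zero _ _ |>.2 fun k hk =>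
      Polynomial.coeff_eq_zero_of_natDegree_lt ((natDegree_star_le hm).trans_lt (by omega))

/-- The Szegő recursion. -/
theorem szego_recursion (hμ : IsNontrivial μ) (n : ℕ) :
    monicOP μ (n + 1) = Polynomial.X * monicOP μ n -
      Polynomial.C (conj (verblunsky μ n)) * starOP μ n := by
  -- The leading terms cancel and the choice of `α_n` makes `R(0) = 0`, so `R` lies in the span of
  -- `z, …, z^n`. All three summands are orthogonal to that span, hence `R` is orthogonal to itself.
  set R := monicOP μ (n + 1) - Polynomial.X * monicOP μ n +
    Polynomial.C (conj (verblunsky μ n)) * starOP μ n with hR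
  have hXm : (Polynomial.X * monicOP μ n).natDegree = n + 1 := by
    rw [Polynomial.natDegree_X_mul (monicOP_monic μ n).ne_zero, natDegree_monicOP]
  have hdeg : R.natDegree ≤ n := by
    refine Polynomial.natDegree_add_le_of_degree_le ?_ ?_
    · rw [Polynomial.natDegree_le_iff_coeff_eq_zero]
      intro k hk
      rcases (Nat.succ_le_of_lt hk).eq_or_lt with rfl | hk'
      · have h1 := (monicOP_monic μ (n + 1)).coeff_natDegree
        have h2 := (Polynomial.monic_X.mul (monicOP_monic μ n)).coeff_natDegree
        rw [natDegree_monicOP] at h1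
        rw [hXm] at h2
        rw [Polynomial.coeff_sub, h1, h2, sub_self]
      · rw [Polynomial.coeff_sub, Polynomial.coeff_eq_zero_of_natDegree_lt,
          Polynomial.coeff_eq_zero_of_natDegree_lt, sub_self]
        · rwa [hXm]
        · rwa [natDegree_monicOP]
    · exact (Polynomial.natDegree_C_mul_le _ _).trans (natDegree_starOP_le μ n)
  have h0 : R.coeff 0 = 0 := by
    rw [Polynomial.coeff_zero_eq_eval_zero, hR]
    simp [eval_starOP_zero, verblunsky]
  obtain ⟨S, hS⟩ := Polynomial.X_dvd_iff.2 h0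
  rw [hS] at hdeg
  have hself : polyInner μ R R = 0 := by
    nth_rw 2 [hR]
    rw [hS, polyInner_add_right, polyInner_sub_right, polyInner_C_mul_right,
      polyInner_eq_zero_comm μ (polyInner_starOP_X_mul hμ hdeg), polyInner_X_mul,
      polyInner_eq_zero_comm μ (polyInner_monicOP_of_degree_lt hμ (n + 1) (Polynomial.X * S)
        (Polynomial.degree_le_natDegree.trans_lt (Nat.cast_lt.2 (by omega))))]
    rcases natDegree_lt_or_eq_zero_of_X_mul hdeg with rfl | ⟨m, rfl, hm⟩
    · simp [polyInner]
    · rw [polyInner_eq_zero_comm μ (polyInner_monicOP_of_degree_lt hμ (m + 1) S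
        (Polynomial.degree_le_natDegree.trans_lt (Nat.cast_lt.2 (by omega))))]
      simp
  have hR0 : R = 0 := eq_zero_of_normSq_eq_zero hμ
    (by rw [polyInner_self] at hself; exact_mod_cast hself)
  linear_combination hR0 - hR

theorem szego_recursion_eval (hμ : IsNontrivial μ) (n : ℕ) (z : ℂ) :
    (monicOP μ (n + 1)).eval z = z * (monicOP μ n).eval z -
      conj (verblunsky μ n) * (starOP μ n).eval z := by
  rw [szego_recursion hμ]; simp

theorem szego_recursion_star (hμ : IsNontrivial μ) (n : ℕ) (ζ : Circle) :
    (starOP μ (n + 1)).eval (ζ : ℂ) = (starOP μ n).eval (ζ : ℂ) -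
      verblunsky μ n * (ζ * (monicOP μ n).eval (ζ : ℂ)) := by
  rw [eval_starOP, szego_recursion_eval hμ, eval_starOP]
  simp only [map_sub, map_mul, map_pow, Complex.conj_conj]
  have h1 : (ζ : ℂ) ^ n * conj (ζ : ℂ) ^ n = 1 := by
    rw [← mul_pow, mul_comm, conj_coe_mul_coe, one_pow]
  linear_combination (ζ : ℂ) ^ n * conj ((monicOP μ n).eval (ζ : ℂ)) * conj_coe_mul_coe ζ -
    (ζ : ℂ) * verblunsky μ n * (monicOP μ n).eval (ζ : ℂ) * h1

/-- Pythagoras for `zΦ_n = Φ_{n+1} + conj α_n Φ_n^*`, whose summands are orthogonal; multiplication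
by `z` and reversal preserve the norm. -/
theorem normSq_monicOP_succ (hμ : IsNontrivial μ) (n : ℕ) :
    normSq μ (monicOP μ (n + 1)) = (1 - ‖verblunsky μ n‖ ^ 2) * normSq μ (monicOP μ n) := by
  have h1 : Polynomial.X * monicOP μ n = monicOP μ (n + 1) +
      Polynomial.C (conj (verblunsky μ n)) * starOP μ n := by
    rw [szego_recursion hμ]; ring
  have h2 := congrArg (normSq μ) h1
  rw [normSq_X_mul, normSq_add, normSq_C_mul, normSq_starOP, RCLike.norm_conj] at h2
  · linarith
  · rw [polyInner_C_mul_right, polyInner_monicOP_of_degree_lt hμ, mul_zero]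
    exact Polynomial.degree_lt_iff_coeff_zero _ _ |>.2 fun k hk =>
      Polynomial.coeff_eq_zero_of_natDegree_lt ((natDegree_starOP_le μ n).trans_lt (by omega))

theorem norm_verblunsky_lt_one (hμ : IsNontrivial μ) (n : ℕ) : ‖verblunsky μ n‖ < 1 := by
  have h1 := normSq_pos hμ (monicOP_monic μ (n + 1)).ne_zero
  have h2 := normSq_pos hμ (monicOP_monic μ n).ne_zero
  rw [normSq_monicOP_succ hμ] at h1
  have h3 := pos_of_mul_pos_left h1 h2.le
  nlinarith [norm_nonneg (verblunsky μ n)]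

theorem rho_sq (hμ : IsNontrivial μ) (n : ℕ) : rho μ n ^ 2 = 1 - ‖verblunsky μ n‖ ^ 2 :=
  Real.sq_sqrt (by nlinarith [norm_nonneg (verblunsky μ n), norm_verblunsky_lt_one hμ n])

theorem rho_pos (hμ : IsNontrivial μ) (n : ℕ) : 0 < rho μ n :=
  Real.sqrt_pos.2 (by nlinarith [norm_nonneg (verblunsky μ n), norm_verblunsky_lt_one hμ n])

/-- `Φ_n^*` is the minimizer: `Q - Φ_n^*` vanishes at `0`, so it is a combination of `z, …, z^n` and
is orthogonal to `Φ_n^*`. -/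
theorem normSq_le_of_eval_zero_eq_one (hμ : IsNontrivial μ) {n : ℕ} {Q : ℂ[X]}
    (hQ : Q.natDegree ≤ n) (hQ0 : Q.eval 0 = 1) : normSq μ (monicOP μ n) ≤ normSq μ Q := by
  have h0 : (Q - starOP μ n).coeff 0 = 0 := by
    rw [Polynomial.coeff_zero_eq_eval_zero, Polynomial.eval_sub, hQ0, eval_starOP_zero, sub_self]
  obtain ⟨S, hS⟩ := Polynomial.X_dvd_iff.2 h0
  have hdeg : (Polynomial.X * S).natDegree ≤ n := by
    rw [← hS]
    exact (Polynomial.natDegree_sub_le _ _).trans (max_le hQ (natDegree_starOP_le μ n))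
  have hsplit : Q = starOP μ n + Polynomial.X * S := by rw [← hS]; ring
  rw [hsplit, normSq_add μ (polyInner_starOP_X_mul hμ hdeg), normSq_starOP]
  linarith [normSq_nonneg μ (Polynomial.X * S)]

end

theorem normSq_monicOP_eq_prod {μ : Measure Circle} [IsProbabilityMeasure μ]
    (hμ : IsNontrivial μ) (n : ℕ) :
    normSq μ (monicOP μ n) = ∏ j ∈ Finset.range n, (1 - ‖verblunsky μ j‖ ^ 2) := by
  induction n with
  | zero => simp [monicOP_zero, normSq]
  | succ n ih => rw [normSq_monicOP_succ hμ, ih, Finset.prod_range_succ, mul_comm]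

/-! ### Geronimus' theorem through Cauchy transforms -/

section

variable (μ : Measure Circle)

/-- `∫ 2ζ/(ζ-z) Φ_n(ζ) dμ`, the combination `F Φ_n + Ψ_n` with the second kind polynomial. -/
def transU (n : ℕ) (z : ℂ) : ℂ :=
  ∫ ζ : Circle, 2 * (ζ : ℂ) / (ζ - z) * (monicOP μ n).eval (ζ : ℂ) ∂μ

/-- `∫ 2z/(ζ-z) Φ_n^*(ζ) dμ`, the combination `F Φ_n^* - Ψ_n^*` with the second kind polynomial. -/
def transV (n : ℕ) (z : ℂ) : ℂ :=
  ∫ ζ : Circle, 2 * z / ((ζ : ℂ) - z) * (starOP μ n).eval (ζ : ℂ) ∂μ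

variable {μ} {z : ℂ}

theorem continuous_inv_coe_sub (hz : ‖z‖ < 1) : Continuous fun ζ : Circle => ((ζ : ℂ) - z)⁻¹ :=
  (continuous_coe.sub continuous_const).inv₀ fun ζ => coe_sub_ne_zero ζ hz

theorem continuous_herglotz (hz : ‖z‖ < 1) :
    Continuous fun ζ : Circle => ((ζ : ℂ) + z) / ((ζ : ℂ) - z) :=
  (continuous_coe.add continuous_const).mul (continuous_inv_coe_sub hz)

variable [IsProbabilityMeasure μ]

theorem transU_zero (hz : ‖z‖ < 1) : transU μ 0 z = caratheodory μ z + 1 := by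
  have h1 : (1 : ℂ) = ∫ _ζ : Circle, (1 : ℂ) ∂μ := by simp
  rw [transU, caratheodory, h1, ← integral_add (integrable_of_continuous (continuous_herglotz hz))
    (integrable_of_continuous continuous_const)]
  congr 1; ext ζ
  have := coe_sub_ne_zero ζ hz
  rw [monicOP_zero, Polynomial.eval_one]
  field_simp; ring

theorem transV_zero (hz : ‖z‖ < 1) : transV μ 0 z = caratheodory μ z - 1 := by
  have h1 : (1 : ℂ) = ∫ _ζ : Circle, (1 : ℂ) ∂μ := by simp
  rw [transV, caratheodory, h1, ← integral_sub (integrable_of_continuous (continuous_herglotz hz))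
    (integrable_of_continuous continuous_const)]
  congr 1; ext ζ
  have := coe_sub_ne_zero ζ hz
  rw [eval_starOP, monicOP_zero, Polynomial.eval_one, map_one]
  field_simp; ring

/-- Writing `ζ = z + (ζ - z)` in the kernel produces the recursion plus the integral of `2Φ_{n+1}`,
which is zero by orthogonality to `1`. -/
theorem transU_succ (hμ : IsNontrivial μ) (hz : ‖z‖ < 1) (n : ℕ) :
    transU μ (n + 1) z = z * transU μ n z - conj (verblunsky μ n) * transV μ n z := by
  have hc := continuous_eval (monicOP μ n)
  have hs := continuous_eval (starOP μ n)
  have h0 : ∫ ζ : Circle, (monicOP μ (n + 1)).eval (ζ : ℂ) ∂μ = 0 := by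
    have := polyInner_eq_zero_comm μ (polyInner_monicOP_of_degree_lt hμ (n + 1) 1
      (by rw [Polynomial.degree_one]; exact_mod_cast n.succ_pos))
    simpa [polyInner] using this
  have h2 : ∀ ζ : Circle, 2 * (ζ : ℂ) / (ζ - z) * (monicOP μ (n + 1)).eval (ζ : ℂ) =
      z * (2 * (ζ : ℂ) / (ζ - z) * (monicOP μ n).eval (ζ : ℂ)) -
      conj (verblunsky μ n) * (2 * z / ((ζ : ℂ) - z) * (starOP μ n).eval (ζ : ℂ)) +
      2 * (monicOP μ (n + 1)).eval (ζ : ℂ) := by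
    intro ζ
    have := coe_sub_ne_zero ζ hz
    rw [szego_recursion_eval hμ]
    field_simp; ring
  have i1 : Integrable (fun ζ : Circle =>
      2 * (ζ : ℂ) / (ζ - z) * (monicOP μ n).eval (ζ : ℂ)) μ :=
    integrable_of_continuous (((continuous_const.mul continuous_coe).mul
      (continuous_inv_coe_sub hz)).mul hc)
  have i2 : Integrable (fun ζ : Circle =>
      2 * z / ((ζ : ℂ) - z) * (starOP μ n).eval (ζ : ℂ)) μ :=
    integrable_of_continuous ((continuous_const.mul (continuous_inv_coe_sub hz)).mul hs)
  have i3 : Integrable (fun ζ : Circle => (monicOP μ (n + 1)).eval (ζ : ℂ)) μ :=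
    integrable_of_continuous (continuous_eval _)
  rw [transU, integral_congr_ae (Eventually.of_forall h2), transU, transV, ← integral_const_mul,
    ← integral_const_mul, ← integral_sub (i1.const_mul _) (i2.const_mul _)]
  have h3 := integral_add ((i1.const_mul z).sub (i2.const_mul (conj (verblunsky μ n))))
    (i3.const_mul 2)
  rw [integral_const_mul, h0, mul_zero, add_zero] at h3
  exact h3

theorem transV_succ (hμ : IsNontrivial μ) (hz : ‖z‖ < 1) (n : ℕ) :
    transV μ (n + 1) z = transV μ n z - verblunsky μ n * z * transU μ n z := by
  have i1 : Integrable (fun ζ : Circle =>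
      2 * (ζ : ℂ) / (ζ - z) * (monicOP μ n).eval (ζ : ℂ)) μ :=
    integrable_of_continuous (((continuous_const.mul continuous_coe).mul
      (continuous_inv_coe_sub hz)).mul (continuous_eval _))
  have i2 : Integrable (fun ζ : Circle =>
      2 * z / ((ζ : ℂ) - z) * (starOP μ n).eval (ζ : ℂ)) μ :=
    integrable_of_continuous ((continuous_const.mul (continuous_inv_coe_sub hz)).mul
      (continuous_eval _))
  rw [transV, transV, transU, ← integral_const_mul, ← integral_sub i2 (i1.const_mul _)]
  congr 1; ext ζ
  rw [szego_recursion_star hμ]; ring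

/-- A Cauchy type integral of a polynomial, bounded by its `L²` norm. -/
theorem norm_integral_div_le (hz : ‖z‖ < 1) {g : Circle → ℂ}
    (hg1 : ∀ ζ, ‖g ζ‖ = 1) (P : ℂ[X]) :
    ‖∫ ζ : Circle, g ζ / ((ζ : ℂ) - z) * P.eval (ζ : ℂ) ∂μ‖ ≤
      (1 - ‖z‖)⁻¹ * Real.sqrt (normSq μ P) := by
  -- Cauchy–Schwarz against the constant `1`, in the form that the variance of `|P|` under the
  -- probability measure `μ` is nonnegative.
  have hcs : ∫ ζ : Circle, ‖P.eval (ζ : ℂ)‖ ∂μ ≤ Real.sqrt (normSq μ P) := by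
    refine Real.le_sqrt_of_sq_le ?_
    have hc := (continuous_eval P).norm
    set c := ∫ ζ : Circle, ‖P.eval (ζ : ℂ)‖ ∂μ with hcdef
    have h : 0 ≤ ∫ ζ : Circle, (‖P.eval (ζ : ℂ)‖ - c) ^ 2 ∂μ := integral_nonneg fun _ => sq_nonneg _
    have h2 : ∫ ζ : Circle, (‖P.eval (ζ : ℂ)‖ - c) ^ 2 ∂μ = normSq μ P - c ^ 2 := by
      have : ∀ ζ : Circle, (‖P.eval (ζ : ℂ)‖ - c) ^ 2 =
        ‖P.eval (ζ : ℂ)‖ ^ 2 - 2 * c * ‖P.eval (ζ : ℂ)‖ + c ^ 2 := fun ζ => by ring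
      simp_rw [this]
      rw [integral_add, integral_sub, integral_const_mul, ← hcdef, normSq]
      · simp; ring
      · exact integrable_of_continuous (hc.pow 2)
      · exact integrable_of_continuous (continuous_const.mul hc)
      · exact integrable_of_continuous ((hc.pow 2).sub (continuous_const.mul hc))
      · exact integrable_of_continuous continuous_const
    linarith
  calc ‖∫ ζ : Circle, g ζ / ((ζ : ℂ) - z) * P.eval (ζ : ℂ) ∂μ‖
      ≤ ∫ ζ : Circle, (1 - ‖z‖)⁻¹ * ‖P.eval (ζ : ℂ)‖ ∂μ := by
        refine norm_integral_le_of_norm_le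
          (integrable_of_continuous (continuous_const.mul (continuous_eval P).norm))
          (Eventually.of_forall fun ζ => ?_)
        rw [norm_mul, norm_div, hg1, one_div]
        exact mul_le_mul_of_nonneg_right (inv_anti₀ (sub_pos.2 hz) (one_sub_norm_le_norm_sub ζ z))
          (norm_nonneg _)
    _ ≤ _ := by
        rw [integral_const_mul]
        exact mul_le_mul_of_nonneg_left hcs (inv_nonneg.2 (sub_pos.2 hz).le)

/-- Since `ζ/(ζ-z) = 1 + z/(ζ-z)`, each relation `∫ conj ζ^k Φ_n dμ = 0` with `k < n` extracts one
factor `z` from the transform. The remaining integral is bounded by the norm of `Φ_n`. -/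
theorem exists_transU_eq (hμ : IsNontrivial μ) (hz : ‖z‖ < 1) (n : ℕ) :
    ∃ a : ℂ, transU μ n z = z ^ n * a ∧
      ‖a‖ ≤ 2 * (1 - ‖z‖)⁻¹ * Real.sqrt (normSq μ (monicOP μ n)) := by
  have key : ∀ k ≤ n, transU μ n z = z ^ k * (2 * ∫ ζ : Circle,
      conj (ζ : ℂ) ^ k * ζ / ((ζ : ℂ) - z) * (monicOP μ n).eval (ζ : ℂ) ∂μ) := by
    intro k
    induction k with
    | zero =>
      intro _
      rw [transU, ← integral_const_mul, pow_zero, one_mul]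
      congr 1; ext ζ; ring
    | succ k ih =>
      intro hk
      have h0 := polyInner_eq_zero_comm μ (polyInner_monicOP_of_degree_lt hμ n (Polynomial.X ^ k)
        (by rw [Polynomial.degree_X_pow]; exact_mod_cast hk))
      rw [polyInner] at h0
      have i1 : Integrable (fun ζ : Circle => conj (ζ : ℂ) ^ (k + 1) * ζ / ((ζ : ℂ) - z) *
          (monicOP μ n).eval (ζ : ℂ)) μ :=
        integrable_of_continuous ((((continuous_conj_coe.pow _).mul continuous_coe).mul
          (continuous_inv_coe_sub hz)).mul (continuous_eval _))
      have i2 : Integrable (fun ζ : Circle => conj ((Polynomial.X ^ k : ℂ[X]).eval (ζ : ℂ)) *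
          (monicOP μ n).eval (ζ : ℂ)) μ := integrable_of_continuous (continuous_conj_eval_mul _ _)
      have hA : ∫ ζ : Circle, conj (ζ : ℂ) ^ k * ζ / ((ζ : ℂ) - z) *
          (monicOP μ n).eval (ζ : ℂ) ∂μ = z * ∫ ζ : Circle, conj (ζ : ℂ) ^ (k + 1) * ζ /
          ((ζ : ℂ) - z) * (monicOP μ n).eval (ζ : ℂ) ∂μ := by
        rw [← add_zero (z * _), ← h0, ← integral_const_mul, ← integral_add (i1.const_mul z) i2]
        congr 1; ext ζ
        have := coe_sub_ne_zero ζ hz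
        simp only [Polynomial.eval_pow, Polynomial.eval_X, map_pow]
        field_simp
        linear_combination (-z * conj (ζ : ℂ) ^ k * (monicOP μ n).eval (ζ : ℂ)) * conj_coe_mul_coe ζ
      rw [ih (by omega), hA]; ring
  refine ⟨_, key n le_rfl, ?_⟩
  rw [norm_mul, mul_assoc, Complex.norm_ofNat]
  gcongr
  exact norm_integral_div_le hz (fun ζ => by simp [Circle.norm_coe]) _

/-- Factors `z` are extracted as for `transU`, now by orthogonality of `Φ_n^*` to `z, …, z^n`. The
kernel already carries one factor `z`, hence the exponent `n + 1`. -/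
theorem exists_transV_eq (hμ : IsNontrivial μ) (hz : ‖z‖ < 1) (n : ℕ) :
    ∃ b : ℂ, transV μ n z = z ^ (n + 1) * b ∧
      ‖b‖ ≤ 2 * (1 - ‖z‖)⁻¹ * Real.sqrt (normSq μ (monicOP μ n)) := by
  have key : ∀ k ≤ n, transV μ n z = z ^ (k + 1) * (2 * ∫ ζ : Circle,
      conj (ζ : ℂ) ^ k / ((ζ : ℂ) - z) * (starOP μ n).eval (ζ : ℂ) ∂μ) := by
    intro k
    induction k with
    | zero =>
      intro _
      rw [transV, ← integral_const_mul, ← integral_const_mul]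
      congr 1; ext ζ; ring
    | succ k ih =>
      intro hk
      have h0 := polyInner_eq_zero_comm μ (polyInner_starOP_X_mul (S := Polynomial.X ^ k) hμ
        (n := n) (by rw [← pow_succ', Polynomial.natDegree_X_pow]; exact hk))
      rw [polyInner] at h0
      have i1 : Integrable (fun ζ : Circle => conj (ζ : ℂ) ^ (k + 1) / ((ζ : ℂ) - z) *
          (starOP μ n).eval (ζ : ℂ)) μ :=
        integrable_of_continuous (((continuous_conj_coe.pow _).mul
          (continuous_inv_coe_sub hz)).mul (continuous_eval _))
      have i2 : Integrable (fun ζ : Circle =>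
          conj ((Polynomial.X * Polynomial.X ^ k : ℂ[X]).eval (ζ : ℂ)) *
          (starOP μ n).eval (ζ : ℂ)) μ := integrable_of_continuous (continuous_conj_eval_mul _ _)
      have hA : ∫ ζ : Circle, conj (ζ : ℂ) ^ k / ((ζ : ℂ) - z) *
          (starOP μ n).eval (ζ : ℂ) ∂μ = z * ∫ ζ : Circle, conj (ζ : ℂ) ^ (k + 1) /
          ((ζ : ℂ) - z) * (starOP μ n).eval (ζ : ℂ) ∂μ := by
        rw [← add_zero (z * _), ← h0, ← integral_const_mul, ← integral_add (i1.const_mul z) i2]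
        congr 1; ext ζ
        have := coe_sub_ne_zero ζ hz
        simp only [Polynomial.eval_pow, Polynomial.eval_X, Polynomial.eval_mul, map_pow, map_mul]
        field_simp
        linear_combination (-conj (ζ : ℂ) ^ k * (starOP μ n).eval (ζ : ℂ)) * conj_coe_mul_coe ζ
      rw [ih (by omega), hA]; ring
  refine ⟨_, key n le_rfl, ?_⟩
  rw [norm_mul, mul_assoc, Complex.norm_ofNat, ← normSq_starOP]
  gcongr
  exact norm_integral_div_le hz (fun ζ => by simp [Circle.norm_coe]) _

end

/-- Geronimus' theorem, one step: the Carathéodory functions of `μ` and of a measure with the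
shifted Verblunsky coefficients are related by the Schur algorithm. -/
theorem caratheodory_step {μ μ₁ : Measure Circle} [IsProbabilityMeasure μ] [IsProbabilityMeasure μ₁]
    (hμ : IsNontrivial μ) (hμ₁ : IsNontrivial μ₁)
    (h : ∀ j, verblunsky μ₁ j = verblunsky μ (j + 1)) {z : ℂ} (hz : ‖z‖ < 1) (hz0 : z ≠ 0) :
    (z * (caratheodory μ z + 1) - conj (verblunsky μ 0) * (caratheodory μ z - 1)) *
        (caratheodory μ₁ z - 1) =
      (caratheodory μ z - 1 - verblunsky μ 0 * z * (caratheodory μ z + 1)) *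
        (caratheodory μ₁ z + 1) := by
  rw [← transU_zero hz, ← transV_zero hz, ← transU_zero hz, ← transV_zero hz, ← transU_succ hμ hz,
    ← transV_succ hμ hz]
  set N : ℕ → ℝ := fun n => normSq μ₁ (monicOP μ₁ n) with hN
  have hNpos : ∀ n, 0 < N n := fun n => normSq_pos hμ₁ (monicOP_monic μ₁ n).ne_zero
  -- The shift of the Verblunsky coefficients makes `‖Φ_{n+1}‖²` for `μ` equal to `c` times `‖Φ_n‖²`
  -- for `μ₁`, since both change by the same factor.
  set c := normSq μ (monicOP μ 1) with hc
  have hN1 : ∀ n, normSq μ (monicOP μ (n + 1)) = c * N n := by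
    intro n
    induction n with
    | zero => simp [hN, monicOP_zero, normSq, hc]
    | succ n ih =>
      rw [normSq_monicOP_succ hμ, ih, ← h]
      simp only [hN]
      rw [normSq_monicOP_succ hμ₁]; ring
  -- Both pairs of transforms evolve by the same matrix, of determinant `z(1 - |α|²)`. The claim is
  -- `Δ 0 = 0`.
  set Δ : ℕ → ℂ := fun n =>
    transU μ (n + 1) z * transV μ₁ n z - transV μ (n + 1) z * transU μ₁ n z with hΔ
  have hstep : ∀ n, Δ n = z ^ n * N n * Δ 0 := by
    intro n
    induction n with
    | zero => simp [hN, monicOP_zero, normSq]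
    | succ n ih =>
      have e1 : Δ (n + 1) = z * (1 - ‖verblunsky μ₁ n‖ ^ 2) * Δ n := by
        simp only [hΔ]
        rw [transU_succ hμ hz (n + 1), transV_succ hμ hz (n + 1), transU_succ hμ₁ hz n,
          transV_succ hμ₁ hz n, ← h]
        have := Complex.conj_mul' (verblunsky μ₁ n)
        linear_combination (- z) * (transU μ (n + 1) z * transV μ₁ n z -
          transV μ (n + 1) z * transU μ₁ n z) * this
      rw [e1, ih]
      simp only [hN]
      rw [normSq_monicOP_succ hμ₁]
      push_cast; ring
  set M : ℝ := (2 * (1 - ‖z‖)⁻¹) ^ 2 * Real.sqrt c with hM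
  have hbound : ∀ n, ‖Δ 0‖ ≤ 2 * M * ‖z‖ ^ n := by
    intro n
    obtain ⟨a, ha, ha'⟩ := exists_transU_eq hμ hz (n + 1)
    obtain ⟨b, hb, hb'⟩ := exists_transV_eq hμ hz (n + 1)
    obtain ⟨a₁, ha₁, ha₁'⟩ := exists_transU_eq hμ₁ hz n
    obtain ⟨b₁, hb₁, hb₁'⟩ := exists_transV_eq hμ₁ hz n
    have hz1 : 0 < 1 - ‖z‖ := sub_pos.2 hz
    rw [hN1, Real.sqrt_mul (normSq_nonneg _ _)] at ha' hb'
    have hs : Real.sqrt (N n) * Real.sqrt (N n) = N n := Real.mul_self_sqrt (hNpos n).le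
    have p1 : ‖a * b₁‖ ≤ M * N n := by
      rw [norm_mul]
      refine (mul_le_mul ha' hb₁' (norm_nonneg _) (by positivity)).trans_eq ?_
      rw [hM]
      linear_combination ((2 * (1 - ‖z‖)⁻¹) ^ 2 * Real.sqrt c) * hs
    have p2 : ‖b * a₁‖ ≤ M * N n := by
      rw [norm_mul]
      refine (mul_le_mul hb' ha₁' (norm_nonneg _) (by positivity)).trans_eq ?_
      rw [hM]
      linear_combination ((2 * (1 - ‖z‖)⁻¹) ^ 2 * Real.sqrt c) * hs
    -- The two products in `Δ n` each carry `z^(2n+2)`, against only `z^n` from the recursion. The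
    -- size `N n` occurs on both sides and cancels, so no lower bound for it is needed even if it
    -- tends to zero.
    have e : z ^ n * (N n * Δ 0) = z ^ n * (z ^ (n + 2) * (a * b₁ - b * a₁)) := by
      rw [← mul_assoc, ← hstep n]
      simp only [hΔ]
      rw [ha, hb, ha₁, hb₁]; ring
    have e' := mul_left_cancel₀ (pow_ne_zero n hz0) e
    have e2 := congrArg norm e'
    rw [norm_mul, norm_mul, Complex.norm_real, Real.norm_of_nonneg (hNpos n).le, norm_pow] at e2
    have e3 : N n * ‖Δ 0‖ ≤ N n * (2 * M * ‖z‖ ^ n) := by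
      rw [e2]
      calc ‖z‖ ^ (n + 2) * ‖a * b₁ - b * a₁‖ ≤ ‖z‖ ^ n * (M * N n + M * N n) := by
            gcongr ?_ * ?_
            · exact pow_le_pow_of_le_one (norm_nonneg _) hz.le (by omega)
            · exact (norm_sub_le _ _).trans (add_le_add p1 p2)
        _ = _ := by ring
    exact le_of_mul_le_mul_left e3 (hNpos n)
  have hlim : Tendsto (fun n => 2 * M * ‖z‖ ^ n) atTop (𝓝 0) := by
    simpa using (tendsto_pow_atTop_nhds_zero_of_lt_one (norm_nonneg z) hz).const_mul (2 * M)
  have h0 : ‖Δ 0‖ ≤ 0 := ge_of_tendsto' hlim hbound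
  exact sub_eq_zero.1 (norm_le_zero_iff.1 h0)

/-! ### Carathéodory and Schur functions -/

/-- The Poisson kernel of the unit disc. -/
def poisson (z : ℂ) (ζ : Circle) : ℝ := (1 - ‖z‖ ^ 2) / ‖(ζ : ℂ) - z‖ ^ 2

theorem re_herglotz (z : ℂ) (ζ : Circle) : (((ζ : ℂ) + z) / ((ζ : ℂ) - z)).re = poisson z ζ := by
  have h1 : Complex.normSq ζ = 1 := by simp
  rw [poisson, Complex.div_re, ← Complex.normSq_eq_norm_sq, ← Complex.normSq_eq_norm_sq, ← h1,
    ← add_div]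
  congr 1
  simp only [Complex.normSq_apply, Complex.add_re, Complex.sub_re, Complex.add_im, Complex.sub_im]
  ring

theorem poisson_pos {z : ℂ} (hz : ‖z‖ < 1) (ζ : Circle) : 0 < poisson z ζ := by
  refine div_pos ?_ (pow_pos (norm_pos_iff.2 (coe_sub_ne_zero ζ hz)) 2)
  nlinarith [norm_nonneg z]

theorem continuous_poisson {z : ℂ} (hz : ‖z‖ < 1) : Continuous (poisson z) := by
  have := Complex.continuous_re.comp (continuous_herglotz hz)
  refine this.congr fun ζ => ?_
  exact re_herglotz z ζ

section

variable (μ : Measure Circle) [IsProbabilityMeasure μ] {z : ℂ}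

theorem re_caratheodory (hz : ‖z‖ < 1) : (caratheodory μ z).re = ∫ ζ, poisson z ζ ∂μ := by
  rw [caratheodory]
  have h := integral_re (𝕜 := ℂ) (integrable_of_continuous (μ := μ) (continuous_herglotz hz))
  simp only [RCLike.re_to_complex] at h
  rw [← h]
  congr 1; ext ζ; exact re_herglotz z ζ

theorem re_caratheodory_pos (hz : ‖z‖ < 1) : 0 < (caratheodory μ z).re := by
  rw [re_caratheodory μ hz, integral_pos_iff_support_of_nonneg (fun ζ => (poisson_pos hz ζ).le)
    (integrable_of_continuous (continuous_poisson hz))]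
  have : Function.support (poisson z) = Set.univ :=
    Set.eq_univ_of_forall fun ζ => (poisson_pos hz ζ).ne'
  simp [this]

theorem caratheodory_zero : caratheodory μ 0 = 1 := by
  have : ∀ ζ : Circle, ((ζ : ℂ) + 0) / ((ζ : ℂ) - 0) = 1 := fun ζ => by simp
  simp [caratheodory]

theorem caratheodory_add_one_ne_zero (hz : ‖z‖ < 1) : caratheodory μ z + 1 ≠ 0 := by
  intro h
  have h1 := re_caratheodory_pos μ hz
  have h2 := congrArg Complex.re h
  simp only [Complex.add_re, Complex.one_re, Complex.zero_re] at h2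
  linarith

theorem differentiableOn_caratheodory :
    DifferentiableOn ℂ (caratheodory μ) (Metric.ball 0 1) := by
  intro z₀ hz₀
  rw [mem_ball_zero_iff] at hz₀
  -- Midway between `‖z₀‖` and `1`: the ball of radius `R` is a neighbourhood of `z₀` on which the
  -- kernel and its derivative are uniformly bounded.
  set R := (1 + ‖z₀‖) / 2 with hR
  have hR1 : R < 1 := by rw [hR]; linarith
  have hs : Metric.ball (0 : ℂ) R ∈ 𝓝 z₀ :=
    Metric.isOpen_ball.mem_nhds (by rw [mem_ball_zero_iff, hR]; linarith)
  refine (hasDerivAt_integral_of_dominated_loc_of_deriv_le (μ := μ)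
    (F := fun z (ζ : Circle) => ((ζ : ℂ) + z) / ((ζ : ℂ) - z))
    (F' := fun z (ζ : Circle) => 2 * (ζ : ℂ) / ((ζ : ℂ) - z) ^ 2)
    (bound := fun _ => 2 / (1 - R) ^ 2) hs ?_ ?_ ?_ ?_ ?_
    ?_).2.differentiableAt.differentiableWithinAt
  · filter_upwards [hs] with z hz
    rw [mem_ball_zero_iff] at hz
    exact (continuous_herglotz (hz.trans hR1)).aestronglyMeasurable
  · exact integrable_of_continuous (continuous_herglotz hz₀)
  · refine Continuous.aestronglyMeasurable ?_
    exact (continuous_const.mul continuous_coe).div ((continuous_coe.sub continuous_const).pow 2)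
      fun ζ => pow_ne_zero 2 (coe_sub_ne_zero ζ hz₀)
  · refine Eventually.of_forall fun ζ z hz => ?_
    rw [mem_ball_zero_iff] at hz
    rw [norm_div, norm_mul, norm_pow, Circle.norm_coe, mul_one, Complex.norm_ofNat]
    have h1 := one_sub_norm_le_norm_sub ζ z
    have h2 : 0 < 1 - R := sub_pos.2 hR1
    gcongr
    linarith
  · exact integrable_const _
  · refine Eventually.of_forall fun ζ z hz => ?_
    rw [mem_ball_zero_iff] at hz
    have hne := coe_sub_ne_zero ζ (hz.trans hR1)
    have h1 : HasDerivAt (fun z : ℂ => (ζ : ℂ) + z) 1 z := (hasDerivAt_id z).const_add _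
    have h2 : HasDerivAt (fun z : ℂ => (ζ : ℂ) - z) (-1) z := (hasDerivAt_id z).const_sub _
    exact (h1.fun_div h2 hne).congr_deriv (by ring)

theorem norm_cayley_lt_one {w : ℂ} (hw : 0 < w.re) : ‖(w - 1) / (w + 1)‖ < 1 := by
  have h : w + 1 ≠ 0 := fun h => by
    have := congrArg Complex.re h
    simp only [Complex.add_re, Complex.one_re, Complex.zero_re] at this
    linarith
  rw [norm_div, div_lt_one (norm_pos_iff.2 h), ← sq_lt_sq₀ (norm_nonneg _) (norm_nonneg _),
    ← Complex.normSq_eq_norm_sq, ← Complex.normSq_eq_norm_sq, Complex.normSq_apply,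
    Complex.normSq_apply]
  simp only [Complex.add_re, Complex.sub_re, Complex.add_im, Complex.sub_im, Complex.one_re,
    Complex.one_im]
  linarith

theorem differentiableOn_cayley_caratheodory :
    DifferentiableOn ℂ (fun z => (caratheodory μ z - 1) / (caratheodory μ z + 1))
      (Metric.ball 0 1) :=
  ((differentiableOn_caratheodory μ).sub_const 1).div
    ((differentiableOn_caratheodory μ).add_const 1)
    fun _ hz => caratheodory_add_one_ne_zero μ (mem_ball_zero_iff.1 hz)

theorem differentiableOn_schur : DifferentiableOn ℂ (schur μ) (Metric.ball 0 1) :=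
  (Complex.differentiableOn_dslope (Metric.ball_mem_nhds 0 one_pos)).2
    (differentiableOn_cayley_caratheodory μ)

/-- The Schwarz lemma for `(F - 1)/(F + 1)`, which maps the disc to itself and fixes `0`. -/
theorem norm_schur_le_one (hz : ‖z‖ < 1) : ‖schur μ z‖ ≤ 1 := by
  have h := Complex.norm_dslope_le_div_of_mapsTo_ball (c := 0) (R₁ := 1) (R₂ := 1)
    (differentiableOn_cayley_caratheodory μ) (z := z) ?_ (mem_ball_zero_iff.2 hz)
  · simpa [schur] using h
  · intro w hw
    simp only [caratheodory_zero, sub_self, zero_div]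
    exact Metric.ball_subset_closedBall (mem_ball_zero_iff.2
      (norm_cayley_lt_one (re_caratheodory_pos μ (mem_ball_zero_iff.1 hw))))

theorem mul_schur (z : ℂ) :
    z * schur μ z = (caratheodory μ z - 1) / (caratheodory μ z + 1) := by
  have h := sub_smul_dslope (fun z => (caratheodory μ z - 1) / (caratheodory μ z + 1)) 0 z
  simpa [schur, caratheodory_zero] using h

theorem norm_mul_schur_lt_one (hz : ‖z‖ < 1) : ‖z * schur μ z‖ < 1 := by
  rw [mul_schur]
  exact norm_cayley_lt_one (re_caratheodory_pos μ hz)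

theorem caratheodory_eq (hz : ‖z‖ < 1) :
    caratheodory μ z = (1 + z * schur μ z) / (1 - z * schur μ z) := by
  have h := caratheodory_add_one_ne_zero μ hz
  rw [mul_schur]
  have h1 : 1 + (caratheodory μ z - 1) / (caratheodory μ z + 1) =
    2 * caratheodory μ z / (caratheodory μ z + 1) := by field_simp; ring
  have h2 : 1 - (caratheodory μ z - 1) / (caratheodory μ z + 1) =
    2 / (caratheodory μ z + 1) := by field_simp; ring
  rw [h1, h2]
  field_simp

theorem re_one_sub_mul_schur_pos (hz : ‖z‖ < 1) : 0 < (1 - z * schur μ z).re := by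
  have := (Complex.re_le_norm _).trans_lt (norm_mul_schur_lt_one μ hz)
  simpa using this

theorem one_sub_mul_schur_ne_zero (hz : ‖z‖ < 1) : 1 - z * schur μ z ≠ 0 := fun h => by
  have := re_one_sub_mul_schur_pos μ hz
  simp [h] at this

theorem re_caratheodory_eq_schur (hz : ‖z‖ < 1) :
    (caratheodory μ z).re * ‖1 - z * schur μ z‖ ^ 2 = 1 - ‖z * schur μ z‖ ^ 2 := by
  have h := one_sub_mul_schur_ne_zero μ hz
  have h1 : (caratheodory μ z).re = ((1 + z * schur μ z) * conj (1 - z * schur μ z)).re /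
      ‖1 - z * schur μ z‖ ^ 2 := by
    rw [caratheodory_eq μ hz, div_eq_mul_inv, Complex.inv_def, ← mul_assoc,
      Complex.re_mul_ofReal, Complex.normSq_eq_norm_sq, div_eq_mul_inv]
  rw [h1, div_mul_cancel₀ _ (pow_ne_zero 2 (norm_ne_zero_iff.2 h)), ← Complex.normSq_eq_norm_sq,
    Complex.normSq_apply]
  simp only [Complex.mul_re, Complex.add_re, Complex.add_im, Complex.conj_re, Complex.conj_im,
    Complex.sub_re, Complex.sub_im, Complex.one_re, Complex.one_im]
  ring

end

/-! ### The Schur algorithm and the modulus of the relative Szegő function -/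

section

variable {μ μ₁ : Measure Circle} [IsProbabilityMeasure μ] [IsProbabilityMeasure μ₁]

/-- The Schur algorithm, one step. -/
theorem schur_step (hμ : IsNontrivial μ) (hμ₁ : IsNontrivial μ₁)
    (h : ∀ j, verblunsky μ₁ j = verblunsky μ (j + 1)) {z : ℂ} (hz : ‖z‖ < 1) :
    schur μ z - verblunsky μ 0 =
      z * schur μ₁ z * (1 - conj (verblunsky μ 0) * schur μ z) := by
  have hne : ∀ z : ℂ, ‖z‖ < 1 → z ≠ 0 → schur μ z - verblunsky μ 0 =
      z * schur μ₁ z * (1 - conj (verblunsky μ 0) * schur μ z) := by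
    intro z hz hz0
    have h1 := caratheodory_step hμ hμ₁ h hz hz0
    have hF := caratheodory_add_one_ne_zero μ hz
    have hF₁ := caratheodory_add_one_ne_zero μ₁ hz
    have e1 : caratheodory μ z - 1 = z * schur μ z * (caratheodory μ z + 1) := by
      rw [mul_schur]; field_simp
    have e2 : caratheodory μ₁ z - 1 = z * schur μ₁ z * (caratheodory μ₁ z + 1) := by
      rw [mul_schur]; field_simp
    rw [e1, e2] at h1
    refine mul_left_cancel₀ (mul_ne_zero (mul_ne_zero hz0 hF) hF₁) ?_
    linear_combination -h1
  -- Away from `0` a factor `z` has been cancelled; the value at `0` follows by continuity.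
  rcases ne_or_eq z 0 with hz0 | rfl
  · exact hne z hz hz0
  · have hc : ∀ ν : Measure Circle, IsProbabilityMeasure ν → ContinuousAt (schur ν) 0 :=
      fun ν _ => ((differentiableOn_schur ν).differentiableAt
        (Metric.ball_mem_nhds 0 one_pos)).continuousAt
    have c1 : ContinuousAt (fun z => schur μ z - verblunsky μ 0) 0 :=
      (hc μ ‹_›).sub continuousAt_const
    have c2 : ContinuousAt (fun z => z * schur μ₁ z *
        (1 - conj (verblunsky μ 0) * schur μ z)) 0 :=
      (continuousAt_id.mul (hc μ₁ ‹_›)).mul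
        (continuousAt_const.sub (continuousAt_const.mul (hc μ ‹_›)))
    refine tendsto_nhds_unique_of_eventuallyEq (c1.tendsto.mono_left nhdsWithin_le_nhds)
      (c2.tendsto.mono_left nhdsWithin_le_nhds) ?_ (l := 𝓝[≠] (0 : ℂ))
    filter_upwards [self_mem_nhdsWithin,
      nhdsWithin_le_nhds (Metric.ball_mem_nhds (0 : ℂ) one_pos)] with z hz0 hz1
    exact hne z (mem_ball_zero_iff.1 hz1) hz0

theorem schur_zero (hμ : IsNontrivial μ) (hμ₁ : IsNontrivial μ₁)
    (h : ∀ j, verblunsky μ₁ j = verblunsky μ (j + 1)) : schur μ 0 = verblunsky μ 0 := by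
  have := schur_step hμ hμ₁ h (z := 0) (by simp)
  rw [zero_mul, zero_mul] at this
  exact sub_eq_zero.1 this

/-- The modulus of the relative Szegő function in terms of the real parts of the two Carathéodory
functions. -/
theorem norm_relSzego_sq_mul (hμ : IsNontrivial μ) (hμ₁ : IsNontrivial μ₁)
    (h : ∀ j, verblunsky μ₁ j = verblunsky μ (j + 1)) {z : ℂ} (hz : ‖z‖ < 1) :
    ‖relSzego μ μ₁ z‖ ^ 2 * (caratheodory μ₁ z).re = (caratheodory μ z).re -
      (1 - ‖z‖ ^ 2) * (‖schur μ z‖ ^ 2 / ‖1 - z * schur μ z‖ ^ 2) := by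
  have hρ := rho_sq hμ 0
  have hρ0 := (rho_pos hμ 0).ne'
  have hg := norm_ne_zero_iff.2 (one_sub_mul_schur_ne_zero μ hz)
  have hF := re_caratheodory_eq_schur μ hz
  have hF₁ := re_caratheodory_eq_schur μ₁ hz
  have hs := schur_step hμ hμ₁ h hz
  -- The identity `|1 - conj α f|² - |f - α|² = (1 - |α|²)(1 - |f|²)`. It produces `1 - |f|²`, while
  -- `Re F` involves `1 - |z f|²`; the difference `(1 - |z|²)|f|²` is the correction term.
  have hid : ‖1 - conj (verblunsky μ 0) * schur μ z‖ ^ 2 * (1 - ‖z * schur μ₁ z‖ ^ 2) =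
      (1 - ‖verblunsky μ 0‖ ^ 2) * (1 - ‖schur μ z‖ ^ 2) := by
    have h1 : ‖schur μ z - verblunsky μ 0‖ ^ 2 =
        ‖z * schur μ₁ z‖ ^ 2 * ‖1 - conj (verblunsky μ 0) * schur μ z‖ ^ 2 := by
      rw [hs, norm_mul, mul_pow]
    rw [mul_sub, mul_one, mul_comm (_ ^ 2) (‖z * schur μ₁ z‖ ^ 2), ← h1]
    simp only [← Complex.normSq_eq_norm_sq, Complex.normSq_apply, Complex.mul_re, Complex.mul_im,
      Complex.conj_re, Complex.conj_im, Complex.sub_re, Complex.sub_im, Complex.one_re,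
      Complex.one_im]
    ring
  have hn : ‖relSzego μ μ₁ z‖ ^ 2 = ‖1 - conj (verblunsky μ 0) * schur μ z‖ ^ 2 / rho μ 0 ^ 2 *
      (‖1 - z * schur μ₁ z‖ ^ 2 / ‖1 - z * schur μ z‖ ^ 2) := by
    rw [relSzego, norm_mul, norm_div, norm_div, Complex.norm_real,
      Real.norm_of_nonneg (rho_pos hμ 0).le]
    ring
  rw [hn]
  rw [norm_mul] at hF
  rw [← hρ] at hid
  generalize ‖1 - z * schur μ z‖ = g at *
  field_simp
  linear_combination ‖1 - conj (verblunsky μ 0) * schur μ z‖ ^ 2 * hF₁ + hid - rho μ 0 ^ 2 * hF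

end

/-! ### Boundary behaviour of Poisson integrals -/

theorem norm_ofReal_mul_coe {r : ℝ} (hr : 0 ≤ r) (ζ : Circle) : ‖(r : ℂ) * ζ‖ = r := by
  rw [norm_mul, Circle.norm_coe, mul_one, Complex.norm_real, Real.norm_of_nonneg hr]

/-- `|ξ - rζ| = |ζ - rξ|` on the circle. It transfers the normalization of the kernel from one
variable to the other. -/
theorem poisson_symm (r : ℝ) (ζ ξ : Circle) : poisson (r * ζ) ξ = poisson (r * ξ) ζ := by
  have h1 : ∀ ζ : Circle, (ζ : ℂ).re * (ζ : ℂ).re + (ζ : ℂ).im * (ζ : ℂ).im = 1 := fun ζ => by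
    rw [← Complex.normSq_apply]; simp
  rw [poisson, poisson, norm_mul, norm_mul, Circle.norm_coe, Circle.norm_coe,
    ← Complex.normSq_eq_norm_sq, ← Complex.normSq_eq_norm_sq, Complex.normSq_apply,
    Complex.normSq_apply]
  congr 1
  simp only [Complex.sub_re, Complex.sub_im, Complex.mul_re, Complex.mul_im, Complex.ofReal_re,
    Complex.ofReal_im]
  linear_combination (1 - r ^ 2) * (h1 ξ - h1 ζ)

theorem continuous_uncurry_poisson {r : ℝ} (hr0 : 0 ≤ r) (hr1 : r < 1) :
    Continuous fun p : Circle × Circle => poisson (r * p.1) p.2 := by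
  have h1 : Continuous fun p : Circle × Circle => (r : ℂ) * (p.1 : ℂ) :=
    continuous_const.mul (continuous_coe.comp continuous_fst)
  have h2 : Continuous fun p : Circle × Circle => (p.2 : ℂ) := continuous_coe.comp continuous_snd
  refine (continuous_const.sub (h1.norm.pow 2)).div ((h2.sub h1).norm.pow 2) fun p => ?_
  exact pow_ne_zero 2 (norm_ne_zero_iff.2 (coe_sub_ne_zero _ (by rwa [norm_ofReal_mul_coe hr0])))

theorem integral_poisson_arc {r : ℝ} (hr0 : 0 ≤ r) (hr1 : r < 1) (ξ : Circle) :
    ∫ ζ : Circle, poisson (r * ζ) ξ ∂arc = 1 := by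
  have hc : Continuous fun ζ : Circle => ((ξ : ℂ) + r * ζ) / ((ξ : ℂ) - r * ζ) := by
    have h1 : Continuous fun ζ : Circle => (r : ℂ) * (ζ : ℂ) := continuous_const.mul continuous_coe
    exact (continuous_const.add h1).div (continuous_const.sub h1)
      fun ζ => coe_sub_ne_zero _ (by rwa [norm_ofReal_mul_coe hr0])
  have hd : DifferentiableOn ℂ (fun z : ℂ => ((ξ : ℂ) + z) / ((ξ : ℂ) - z))
      (Metric.closedBall 0 r) := by
    intro z hz
    refine DifferentiableAt.differentiableWithinAt ?_
    have hne := coe_sub_ne_zero ξ ((mem_closedBall_zero_iff.1 hz).trans_lt hr1)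
    fun_prop (disch := exact hne)
  have hmv := (hd.diffContOnCl_ball (U := Metric.closedBall 0 r)
    (c := 0) (R := |r|) (by rw [abs_of_nonneg hr0])).circleAverage
  have h1 : ∫ ζ : Circle, ((ξ : ℂ) + r * ζ) / ((ξ : ℂ) - r * ζ) ∂arc = 1 := by
    rw [integral_arc_eq_circleAverage (g := fun z : ℂ => ((ξ : ℂ) + z) / ((ξ : ℂ) - z))
      hc.stronglyMeasurable, hmv]
    simp
  have h := integral_re (𝕜 := ℂ) (integrable_of_continuous (μ := arc) hc)
  rw [h1] at h
  simp only [RCLike.re_to_complex, Complex.one_re] at h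
  rw [← h]
  congr 1; ext ζ; exact (re_herglotz _ _).symm

/-- Fubini: for fixed `ξ` the kernel has mean one in `ζ`. Applied to nonnegative densities, it
controls the `L¹` size of an error term uniformly in `r`. -/
theorem integral_poisson_mul {ν : Measure Circle} [IsFiniteMeasure ν] {h : Circle → ℝ}
    (hh : Integrable h ν) {r : ℝ} (hr0 : 0 ≤ r) (hr1 : r < 1) :
    Integrable (fun ζ : Circle => ∫ ξ, poisson (r * ζ) ξ * h ξ ∂ν) arc ∧
      ∫ ζ : Circle, ∫ ξ, poisson (r * ζ) ξ * h ξ ∂ν ∂arc = ∫ ξ, h ξ ∂ν := by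
  have hc := continuous_uncurry_poisson hr0 hr1
  obtain ⟨C, hC⟩ := isCompact_univ.exists_bound_of_continuousOn hc.continuousOn
  have hi : Integrable (fun p : Circle × Circle => poisson (r * p.1) p.2 * h p.2)
      (arc.prod ν) :=
    (hh.comp_snd arc).bdd_mul hc.aestronglyMeasurable
      (Eventually.of_forall fun p => hC p (Set.mem_univ p))
  refine ⟨hi.integral_prod_left, ?_⟩
  rw [integral_integral_swap hi]
  congr 1; ext ξ
  rw [integral_mul_const, integral_poisson_arc hr0 hr1, one_mul]

/-- Moving from `ζ` to `rζ` costs `1 - r ≤ d/2`, so the denominator of the kernel is still at least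
`(d/2)²`. -/
theorem poisson_le {r d : ℝ} (hr1 : r < 1) (hr0 : 0 ≤ r) (hd : 0 < d) (hrd : 1 - r ≤ d / 2)
    {ζ ξ : Circle} (h : d ≤ dist ξ ζ) : poisson (r * ζ) ξ ≤ (1 - r ^ 2) * (4 / d ^ 2) := by
  have h1 : d / 2 ≤ ‖(ξ : ℂ) - r * ζ‖ := by
    have h2 : dist ξ ζ = ‖(ξ : ℂ) - ζ‖ := dist_eq_norm (ξ : ℂ) ζ
    have h3 : ‖(ξ : ℂ) - ζ‖ ≤ ‖(ξ : ℂ) - r * ζ‖ + ‖((r : ℂ) - 1) * ζ‖ := by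
      refine le_trans (le_of_eq ?_) (norm_add_le _ _)
      congr 1; ring
    have h4 : ‖((r : ℂ) - 1) * ζ‖ = 1 - r := by
      rw [norm_mul, Circle.norm_coe, mul_one, ← Complex.ofReal_one, ← Complex.ofReal_sub,
        Complex.norm_real, Real.norm_eq_abs, abs_of_neg (by linarith)]
      ring
    linarith
  rw [poisson, norm_ofReal_mul_coe hr0, div_eq_mul_inv]
  refine mul_le_mul_of_nonneg_left ?_ (by nlinarith)
  rw [show 4 / d ^ 2 = ((d / 2) ^ 2)⁻¹ by field_simp; norm_num]
  exact inv_anti₀ (by positivity) (pow_le_pow_left₀ (by positivity) h1 2)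

section

variable {r : ℕ → ℝ} (hr0 : ∀ k, 0 ≤ r k) (hr1 : ∀ k, r k < 1) (hr : Tendsto r atTop (𝓝 1))
include hr0 hr1 hr

theorem tendstoUniformlyOn_poisson {ζ : Circle} {u : Set Circle} (hu : u ∈ 𝓝 ζ) :
    TendstoUniformlyOn (fun k ξ => poisson (r k * ζ) ξ) 0 atTop uᶜ := by
  obtain ⟨d, hd, hdu⟩ := Metric.mem_nhds_iff.1 hu
  have hlim : Tendsto (fun k => (1 - r k ^ 2) * (4 / d ^ 2)) atTop (𝓝 0) := by
    simpa using ((hr.pow 2).const_sub 1).mul_const (4 / d ^ 2)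
  rw [Metric.tendstoUniformlyOn_iff]
  intro ε hε
  have h1 : ∀ᶠ k in atTop, 1 - d / 2 < r k := hr.eventually_const_lt (by linarith)
  filter_upwards [hlim.eventually_lt_const hε, h1] with k hk hk1 ξ hξ
  have hdist : d ≤ dist ξ ζ := not_lt.1 fun h => hξ (hdu h)
  have h0 := poisson_pos (z := r k * ζ) (by rw [norm_ofReal_mul_coe (hr0 k)]; exact hr1 k) ξ
  rw [Pi.zero_apply, dist_zero_left, Real.norm_of_nonneg h0.le]
  exact (poisson_le (hr1 k) (hr0 k) hd (by linarith) hdist).trans_lt hk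

theorem tendsto_integral_poisson_of_isClosed {ν : Measure Circle} [IsFiniteMeasure ν]
    {K : Set Circle} (hK : IsClosed K) {ζ : Circle} (hζ : ζ ∉ K) :
    Tendsto (fun k => ∫ ξ in K, poisson (r k * ζ) ξ ∂ν) atTop (𝓝 0) := by
  have h := tendstoUniformlyOn_poisson hr0 hr1 hr (hK.isOpen_compl.mem_nhds hζ)
  rw [compl_compl, Metric.tendstoUniformlyOn_iff] at h
  rw [Metric.tendsto_nhds]
  intro ε hε
  filter_upwards [h (ε / (ν.real K + 1)) (by positivity)] with k hk
  rw [dist_zero_right]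
  refine (norm_setIntegral_le_of_norm_le_const (C := ε / (ν.real K + 1)) (measure_lt_top _ _)
    fun ξ hξ => ?_).trans_lt ?_
  · have := (hk ξ hξ).le
    rwa [Pi.zero_apply, dist_zero_left] at this
  · rw [div_mul_eq_mul_div, div_lt_iff₀ (by positivity)]
    nlinarith [measureReal_nonneg (μ := ν) (s := K)]

theorem tendsto_integral_poisson_mul_continuous {g : Circle → ℝ} (hg : Continuous g)
    (ζ : Circle) :
    Tendsto (fun k => ∫ ξ, poisson (r k * ζ) ξ * g ξ ∂arc) atTop (𝓝 (g ζ)) := by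
  have h := tendsto_setIntegral_peak_smul_of_integrableOn_of_tendsto (μ := arc) (s := Set.univ)
    (t := Set.univ) (x₀ := ζ) (g := g) (a := g ζ) (l := atTop)
    (φ := fun k ξ => poisson (r k * ζ) ξ)
    MeasurableSet.univ MeasurableSet.univ subset_rfl (by simp) (by simp)
    (Eventually.of_forall fun k ξ _ => (poisson_pos
      (by rw [norm_ofReal_mul_coe (hr0 k)]; exact hr1 k) ξ).le)
    (fun u hu hζ => by
      rw [← Set.compl_eq_univ_sdiff]
      exact tendstoUniformlyOn_poisson hr0 hr1 hr (hu.mem_nhds hζ))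
    (by
      simp_rw [Measure.restrict_univ, poisson_symm _ ζ]
      simp_rw [integral_poisson_arc (hr0 _) (hr1 _)]
      exact tendsto_const_nhds)
    (Eventually.of_forall fun k => (continuous_poisson
      (by rw [norm_ofReal_mul_coe (hr0 k)]; exact hr1 k)).aestronglyMeasurable)
    (integrable_of_continuous hg).integrableOn
    (hg.tendsto ζ |>.mono_left nhdsWithin_le_nhds)
  simpa using h

/-- The Poisson integral of a finite measure tends in measure to the density of its absolutely
continuous part, along any sequence of radii tending to one. -/
theorem tendstoInMeasure_integral_poisson (μ : Measure Circle) [IsFiniteMeasure μ] :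
    TendstoInMeasure arc (fun k (ζ : Circle) => ∫ ξ, poisson (r k * ζ) ξ ∂μ) atTop
      (weight μ) := by
  rw [tendstoInMeasure_iff_measureReal_norm]
  intro δ hδ
  rw [Metric.tendsto_nhds]
  intro η hη
  -- With this choice Markov's inequality gives the error `B`, of integral at most `3ε`, measure at
  -- most `3η/8 < η/2` on the set where it reaches `δ/2`.
  set ε := δ * η / 16 with hε
  have hε0 : 0 < ε := by positivity
  set σ := μ.singularPart arc with hσ
  have hwi : Integrable (weight μ) arc := Measure.integrable_toReal_rnDeriv
  obtain ⟨s, hs, hσs, hsarc⟩ := Measure.mutuallySingular_singularPart μ arc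
  -- `K` is an `arc`-null compact set carrying all but `ε` of the singular part. Poisson integrals
  -- over `K` tend to zero off `K`, hence a.e.
  obtain ⟨K, hKs, -, hKc, hKε⟩ := hs.compl.exists_isCompact_isClosed_sdiff_lt (μ := σ)
    (measure_ne_top _ _) (ε := ENNReal.ofReal ε) (by positivity)
  have hKarc : arc K = 0 := measure_mono_null hKs hsarc
  have hσK : σ.real Kᶜ ≤ ε := by
    refine ENNReal.toReal_le_of_le_ofReal hε0.le ?_
    calc σ Kᶜ ≤ σ (s ∪ sᶜ \ K) := measure_mono fun x hx => by
            by_cases hxs : x ∈ s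
            · exact Or.inl hxs
            · exact Or.inr ⟨hxs, hx⟩
      _ ≤ σ s + σ (sᶜ \ K) := measure_union_le _ _
      _ ≤ ENNReal.ofReal ε := by rw [hσs, zero_add]; exact hKε.le
  obtain ⟨g, hg, hgi⟩ := hwi.exists_boundedContinuous_integral_sub_le hε0
  have hwg : Integrable (fun ζ => |weight μ ζ - g ζ|) arc := (hwi.sub hgi).abs
  -- `A` collects what converges a.e. to zero, namely the singular mass on `K` and the continuous
  -- approximation `g` of the weight. `B` collects what is only small in `L¹`, uniformly in `k`.
  set A : ℕ → Circle → ℝ := fun k ζ => ∫ ξ in K, poisson (r k * ζ) ξ * 1 ∂σ +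
    |∫ ξ, poisson (r k * ζ) ξ * g ξ ∂arc - g ζ| with hA
  set B : ℕ → Circle → ℝ := fun k ζ => ∫ ξ in Kᶜ, poisson (r k * ζ) ξ * 1 ∂σ +
    ∫ ξ, poisson (r k * ζ) ξ * |weight μ ξ - g ξ| ∂arc + |weight μ ζ - g ζ| with hB
  have hAm : ∀ k, AEStronglyMeasurable (A k) arc := fun k =>
    (integral_poisson_mul (integrable_const 1) (hr0 k) (hr1 k)).1.aestronglyMeasurable.add
      ((integral_poisson_mul hgi (hr0 k) (hr1 k)).1.sub hgi).abs.aestronglyMeasurable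
  have hAlim : TendstoInMeasure arc A atTop (fun _ => (0 : ℝ)) := by
    refine tendstoInMeasure_of_tendsto_ae hAm ?_
    have hae : ∀ᵐ ζ ∂arc, ζ ∉ K := measure_eq_zero_iff_ae_notMem.1 hKarc
    filter_upwards [hae] with ζ hζ
    have h1 := tendsto_integral_poisson_of_isClosed hr0 hr1 hr (ν := σ) hKc hζ
    have h2 := ((tendsto_integral_poisson_mul_continuous hr0 hr1 hr g.continuous ζ).sub_const
      (g ζ)).abs
    simpa [hA] using h1.add h2
  have hBi : ∀ k, Integrable (B k) arc := fun k =>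
    ((integral_poisson_mul (integrable_const 1) (hr0 k) (hr1 k)).1.add
      (integral_poisson_mul hwg (hr0 k) (hr1 k)).1).add hwg
  have hBint : ∀ k, ∫ ζ, B k ζ ∂arc ≤ 3 * ε := by
    intro k
    have h1 := integral_poisson_mul (integrable_const (μ := σ.restrict Kᶜ) (1 : ℝ)) (hr0 k) (hr1 k)
    have h2 := integral_poisson_mul hwg (hr0 k) (hr1 k)
    have h3 : ∫ ζ, |weight μ ζ - g ζ| ∂arc ≤ ε := hg
    have h4 : ∫ ζ, B k ζ ∂arc = σ.real Kᶜ + ∫ ζ, |weight μ ζ - g ζ| ∂arc +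
        ∫ ζ, |weight μ ζ - g ζ| ∂arc := by
      simp only [hB]
      rw [integral_add (h1.1.fun_add h2.1) hwg, integral_add h1.1 h2.1, h1.2, h2.2]
      simp
    linarith
  have hPnn : ∀ k (ζ ξ : Circle), 0 ≤ poisson (r k * ζ) ξ := fun k ζ ξ =>
    (poisson_pos (by rw [norm_ofReal_mul_coe (hr0 k)]; exact hr1 k) ξ).le
  have hBnn : ∀ k ζ, 0 ≤ B k ζ := fun k ζ => by
    refine add_nonneg (add_nonneg ?_ ?_) (abs_nonneg _)
    · exact integral_nonneg fun ξ => by simpa using hPnn k ζ ξ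
    · exact integral_nonneg fun ξ => mul_nonneg (hPnn k ζ ξ) (abs_nonneg _)
  have hle : ∀ k (ζ : Circle), ‖∫ ξ, poisson (r k * ζ) ξ ∂μ - weight μ ζ‖ ≤ A k ζ + B k ζ := by
    intro k ζ
    have hPc : Continuous (poisson (r k * ζ)) :=
      continuous_poisson (by rw [norm_ofReal_mul_coe (hr0 k)]; exact hr1 k)
    obtain ⟨C, hC⟩ := isCompact_univ.exists_bound_of_continuousOn hPc.continuousOn
    have hbdd : ∀ h : Circle → ℝ, Integrable h arc →
        Integrable (fun ξ => poisson (r k * ζ) ξ * h ξ) arc := fun h hh =>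
      hh.bdd_mul hPc.aestronglyMeasurable (Eventually.of_forall fun p => hC p (Set.mem_univ p))
    have e1 : ∫ ξ, poisson (r k * ζ) ξ ∂μ = ∫ ξ in K, poisson (r k * ζ) ξ ∂σ +
        ∫ ξ in Kᶜ, poisson (r k * ζ) ξ ∂σ + ∫ ξ, poisson (r k * ζ) ξ * weight μ ξ ∂arc := by
      rw [integral_add_compl hKc.measurableSet (integrable_of_continuous hPc)]
      conv_lhs => rw [← Measure.singularPart_add_rnDeriv μ arc]
      rw [integral_add_measure (integrable_of_continuous hPc)]
      · congr 1
        rw [integral_withDensity_eq_integral_toReal_smul (Measure.measurable_rnDeriv _ _)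
          (Measure.rnDeriv_lt_top _ _)]
        congr 1; ext ξ; exact mul_comm _ _
      · exact (integrable_of_continuous hPc (μ := μ)).mono_measure
          (Measure.withDensity_rnDeriv_le μ arc)
    have e2 : ∫ ξ, poisson (r k * ζ) ξ * weight μ ξ ∂arc =
        ∫ ξ, poisson (r k * ζ) ξ * (weight μ ξ - g ξ) ∂arc +
        ∫ ξ, poisson (r k * ζ) ξ * g ξ ∂arc := by
      rw [← integral_add (hbdd (fun ξ => weight μ ξ - g ξ) (hwi.sub hgi)) (hbdd _ hgi)]
      congr 1; ext ξ; ring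
    have e3 : |∫ ξ, poisson (r k * ζ) ξ * (weight μ ξ - g ξ) ∂arc| ≤
        ∫ ξ, poisson (r k * ζ) ξ * |weight μ ξ - g ξ| ∂arc := by
      refine abs_integral_le_integral_abs.trans_eq ?_
      congr 1; ext ξ; rw [abs_mul, abs_of_nonneg (hPnn k ζ ξ)]
    have n1 : 0 ≤ ∫ ξ in K, poisson (r k * ζ) ξ ∂σ := integral_nonneg fun ξ => hPnn k ζ ξ
    have n2 : 0 ≤ ∫ ξ in Kᶜ, poisson (r k * ζ) ξ ∂σ := integral_nonneg fun ξ => hPnn k ζ ξ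
    simp only [hA, hB, mul_one]
    rw [e1, e2, Real.norm_eq_abs]
    have a1 := abs_le.1 e3
    have a2 := neg_abs_le (∫ ξ, poisson (r k * ζ) ξ * g ξ ∂arc - g ζ)
    have a3 := le_abs_self (∫ ξ, poisson (r k * ζ) ξ * g ξ ∂arc - g ζ)
    have a4 := neg_abs_le (weight μ ζ - g ζ)
    have a5 := le_abs_self (weight μ ζ - g ζ)
    rw [abs_le]
    constructor <;> linarith [a1.1, a1.2]
  rw [tendstoInMeasure_iff_measureReal_norm] at hAlim
  filter_upwards [(hAlim (δ / 2) (by positivity)).eventually_lt_const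
    (show (0 : ℝ) < η / 2 by positivity)] with k hk
  rw [dist_zero_right, Real.norm_of_nonneg measureReal_nonneg]
  have hmk := mul_meas_ge_le_integral_of_nonneg (Eventually.of_forall (hBnn k)) (hBi k) (δ / 2)
  have hmk' : arc.real {ζ | δ / 2 ≤ B k ζ} < η / 2 := by
    have h5 : δ / 2 * arc.real {ζ | δ / 2 ≤ B k ζ} ≤ δ / 2 * (3 * η / 8) := by
      refine (hmk.trans (hBint k)).trans_eq ?_
      rw [hε]; ring
    have := le_of_mul_le_mul_left h5 (by positivity)
    linarith
  refine (measureReal_mono (s₂ := {ζ | δ / 2 ≤ ‖A k ζ - 0‖} ∪ {ζ | δ / 2 ≤ B k ζ})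
    fun ζ hζ => ?_).trans_lt ((measureReal_union_le _ _).trans_lt (by linarith))
  by_contra hcon
  simp only [Set.mem_union, Set.mem_ofPred_eq, not_or, not_le, sub_zero] at hcon hζ
  have := hle k ζ
  have h6 := Real.le_norm_self (A k ζ)
  linarith [hcon.1, hcon.2]

end

/-! ### Holomorphic functions with bounded imaginary part -/

theorem integral_arc_of_differentiableOn {g : ℂ → ℂ}
    (hg : DifferentiableOn ℂ g (Metric.closedBall 0 1)) : ∫ ζ : Circle, g ζ ∂arc = g 0 := by
  have hc : Continuous fun ζ : Circle => g ((1 : ℝ) * (ζ : ℂ)) := by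
    simp only [Complex.ofReal_one, one_mul]
    exact hg.continuousOn.comp_continuous continuous_coe
      fun ζ => by simp [Circle.norm_coe]
  have h := integral_arc_eq_circleAverage hc.stronglyMeasurable
  rw [(hg.diffContOnCl_ball (U := Metric.closedBall 0 1) (c := 0) (R := |1|)
    (by rw [abs_one])).circleAverage] at h
  simpa using h

theorem integral_arc_cauchy {g : ℂ → ℂ}
    (hg : DifferentiableOn ℂ g (Metric.closedBall 0 1)) {z : ℂ} (hz : ‖z‖ < 1) :
    ∫ ζ : Circle, (ζ : ℂ) / (ζ - z) * g ζ ∂arc = g z := by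
  have hgc : Continuous fun ζ : Circle => g (ζ : ℂ) :=
    hg.continuousOn.comp_continuous continuous_coe fun ζ => by simp [Circle.norm_coe]
  have hc : Continuous fun ζ : Circle => (fun w : ℂ => ((w - 0) / (w - z)) • g w)
      ((1 : ℝ) * (ζ : ℂ)) := by
    simp only [Complex.ofReal_one, one_mul, sub_zero]
    exact (continuous_coe.mul (continuous_inv_coe_sub hz)).smul hgc
  have h := integral_arc_eq_circleAverage (g := fun w : ℂ => ((w - 0) / (w - z)) • g w)
    hc.stronglyMeasurable
  rw [(hg.diffContOnCl_ball (U := Metric.closedBall 0 1) (c := 0) (R := |1|)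
    (by rw [abs_one])).circleAverage_smul_div (by simpa using hz)] at h
  simpa using h

theorem norm_herglotz_le {z : ℂ} (hz : ‖z‖ < 1) (ζ : Circle) :
    ‖((ζ : ℂ) + z) / ((ζ : ℂ) - z)‖ ≤ 2 / (1 - ‖z‖) := by
  rw [norm_div]
  have h1 : ‖(ζ : ℂ) + z‖ ≤ 2 := by
    have := norm_add_le (ζ : ℂ) z
    rw [Circle.norm_coe] at this
    linarith
  exact div_le_div₀ zero_le_two h1 (sub_pos.2 hz) (one_sub_norm_le_norm_sub ζ z)

/-- The Schwarz integral formula on the unit circle. -/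
theorem integral_herglotz_mul_re {g : ℂ → ℂ}
    (hg : DifferentiableOn ℂ g (Metric.closedBall 0 1)) (h0 : (g 0).im = 0) {z : ℂ}
    (hz : ‖z‖ < 1) :
    ∫ ζ : Circle, ((ζ : ℂ) + z) / ((ζ : ℂ) - z) * ((g ζ).re : ℂ) ∂arc = g z := by
  have hgc : Continuous fun ζ : Circle => g (ζ : ℂ) :=
    hg.continuousOn.comp_continuous continuous_coe fun ζ => by simp [Circle.norm_coe]
  have hKc := continuous_herglotz hz
  have h1 := integral_arc_cauchy hg hz
  have h2 := integral_arc_of_differentiableOn hg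
  have hne : ∀ w : ℂ, w ∈ Metric.closedBall (0 : ℂ) 1 → 1 - conj z * w ≠ 0 := by
    intro w hw h
    have hw' := mem_closedBall_zero_iff.1 hw
    have h3 : ‖conj z * w‖ = 1 := by rw [← sub_eq_zero.1 h, norm_one]
    rw [norm_mul, RCLike.norm_conj] at h3
    nlinarith [norm_nonneg z, norm_nonneg w]
  have h3 := integral_arc_of_differentiableOn
    (g := fun w => (1 + conj z * w) / (1 - conj z * w) * g w) (by
      refine DifferentiableOn.mul (DifferentiableOn.div ?_ ?_ hne) hg <;> fun_prop)
  simp only [mul_zero, add_zero, sub_zero, div_one, one_mul] at h3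
  -- On the circle the kernel is the conjugate of `(1 + conj z w)/(1 - conj z w)`, which is
  -- holomorphic on the closed disc with value `1` at `0`. The antiholomorphic half of the real part
  -- therefore contributes only `conj (g 0)`.
  have h4 : ∫ ζ : Circle, ((ζ : ℂ) + z) / ((ζ : ℂ) - z) * conj (g ζ) ∂arc = conj (g 0) := by
    rw [← h3, ← integral_conj]
    congr 1; ext ζ
    have hz1 := coe_sub_ne_zero ζ hz
    have hz2 : 1 - z * conj (ζ : ℂ) ≠ 0 := by
      have := hne ζ (by simp [Circle.norm_coe])
      intro h
      apply this
      have := congrArg conj h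
      simpa using this
    have e : ((ζ : ℂ) + z) / ((ζ : ℂ) - z) = (1 + z * conj (ζ : ℂ)) / (1 - z * conj (ζ : ℂ)) := by
      rw [div_eq_div_iff hz1 hz2]
      linear_combination (-2 * z) * conj_coe_mul_coe ζ
    rw [e]
    simp
  have h5 : ∀ ζ : Circle, ((ζ : ℂ) + z) / ((ζ : ℂ) - z) * ((g ζ).re : ℂ) =
      (ζ : ℂ) / (ζ - z) * g ζ - 2⁻¹ * g ζ +
        2⁻¹ * (((ζ : ℂ) + z) / ((ζ : ℂ) - z) * conj (g ζ)) := by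
    intro ζ
    have hz1 := coe_sub_ne_zero ζ hz
    rw [Complex.re_eq_add_conj]
    field_simp
    ring
  have i1 : Integrable (fun ζ : Circle => (ζ : ℂ) / (ζ - z) * g ζ) arc :=
    integrable_of_continuous ((continuous_coe.mul (continuous_inv_coe_sub hz)).mul hgc)
  have i2 : Integrable (fun ζ : Circle => 2⁻¹ * g ζ) arc :=
    integrable_of_continuous (continuous_const.mul hgc)
  have i3 : Integrable (fun ζ : Circle =>
      2⁻¹ * (((ζ : ℂ) + z) / ((ζ : ℂ) - z) * conj (g ζ))) arc :=
    integrable_of_continuous (continuous_const.mul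
      (hKc.mul (Complex.continuous_conj.comp hgc)))
  have i4 : Integrable (fun ζ : Circle => (ζ : ℂ) / (ζ - z) * g ζ - 2⁻¹ * g ζ) arc := i1.sub i2
  simp_rw [h5]
  rw [integral_add i4 i3, integral_sub i1 i2, integral_const_mul, integral_const_mul,
    h1, h2, h4, Complex.conj_eq_iff_im.2 h0]
  ring

theorem integral_arc_conj_pow_mul_pow (m n : ℕ) :
    ∫ ζ : Circle, conj (ζ : ℂ) ^ m * (ζ : ℂ) ^ n ∂arc = if m = n then 1 else 0 := by
  have hpow : ∀ k : ℕ, k ≠ 0 → ∫ ζ : Circle, (ζ : ℂ) ^ k ∂arc = 0 := fun k hk => by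
    rw [integral_arc_of_differentiableOn (g := fun w => w ^ k) (by fun_prop), zero_pow hk]
  have h1 : ∀ (k : ℕ) (ζ : Circle), conj (ζ : ℂ) ^ k * (ζ : ℂ) ^ k = 1 := fun k ζ => by
    rw [← mul_pow, conj_coe_mul_coe, one_pow]
  rcases lt_trichotomy m n with h | h | h
  · obtain ⟨k, rfl⟩ := Nat.exists_eq_add_of_lt h
    rw [if_neg (by omega), ← hpow (k + 1) (by omega)]
    congr 1; ext ζ
    rw [add_assoc, pow_add, ← mul_assoc, h1, one_mul]
  · subst h
    simp [h1]
  · obtain ⟨k, rfl⟩ := Nat.exists_eq_add_of_lt h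
    rw [if_neg (by omega), ← map_zero (starRingEnd ℂ), ← hpow (k + 1) (by omega), ← integral_conj]
    congr 1; ext ζ
    rw [map_pow, add_assoc, pow_add, mul_assoc, mul_comm, mul_assoc, mul_comm _ (conj (ζ : ℂ) ^ n),
      h1, mul_one]

theorem hasSum_integral_mul {h : ℂ → ℂ} {a : ℕ → ℂ}
    (ha : ∀ r : ℝ, 0 ≤ r → r < 1 → Summable fun n => ‖a n‖ * r ^ n)
    (hs : ∀ z : ℂ, ‖z‖ < 1 → HasSum (fun n => a n * z ^ n) (h z))
    {g : Circle → ℂ} (hg : Continuous g) {r : ℝ} (hr0 : 0 ≤ r) (hr1 : r < 1) :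
    HasSum (fun n => a n * r ^ n * ∫ ζ : Circle, g ζ * (ζ : ℂ) ^ n ∂arc)
      (∫ ζ : Circle, g ζ * h (r * ζ) ∂arc) := by
  have hF := hasSum_integral_of_summable_integral_norm (μ := arc)
    (F := fun n (ζ : Circle) => a n * r ^ n * (g ζ * (ζ : ℂ) ^ n))
    (fun n => integrable_of_continuous (continuous_const.mul (hg.mul (continuous_coe.pow n)))) (by
      have : ∀ n, ∫ ζ : Circle, ‖a n * r ^ n * (g ζ * (ζ : ℂ) ^ n)‖ ∂arc =
          ‖a n‖ * r ^ n * ∫ ζ : Circle, ‖g ζ‖ ∂arc := by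
        intro n
        rw [← integral_const_mul]
        congr 1; ext ζ
        simp [Circle.norm_coe, abs_of_nonneg hr0]
      simp_rw [this]
      exact (ha r hr0 hr1).mul_right _)
  simp_rw [integral_const_mul] at hF
  have hfun : (fun ζ : Circle => g ζ * h (r * ζ)) =
      fun ζ : Circle => ∑' n, a n * r ^ n * (g ζ * (ζ : ℂ) ^ n) := by
    funext ζ
    have := (hs (r * ζ) (by rwa [norm_ofReal_mul_coe hr0])).mul_left (g ζ)
    rw [← this.tsum_eq]
    refine tsum_congr fun n => ?_
    rw [mul_pow]; ring
  rw [hfun]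
  exact hF

section

variable {h : ℂ → ℂ} (hd : DifferentiableOn ℂ h (Metric.ball 0 1))
include hd

theorem differentiableOn_dilation {r : ℝ} (hr0 : 0 ≤ r) (hr1 : r < 1) :
    DifferentiableOn ℂ (fun w => h (r * w)) (Metric.closedBall 0 1) := by
  refine hd.comp (by fun_prop) fun w hw => ?_
  rw [mem_ball_zero_iff, norm_mul, Complex.norm_real, Real.norm_of_nonneg hr0]
  have := mem_closedBall_zero_iff.1 hw
  nlinarith [norm_nonneg w]

theorem continuous_dilation {r : ℝ} (hr0 : 0 ≤ r) (hr1 : r < 1) :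
    Continuous fun ζ : Circle => h (r * ζ) :=
  (differentiableOn_dilation hd hr0 hr1).continuousOn.comp_continuous continuous_coe
    fun ζ => by simp [Circle.norm_coe]

theorem exists_coeff : ∃ a : ℕ → ℂ, (∀ r : ℝ, 0 ≤ r → r < 1 → Summable fun n => ‖a n‖ * r ^ n) ∧
    ∀ z : ℂ, ‖z‖ < 1 → HasSum (fun n => a n * z ^ n) (h z) := by
  have key : ∀ z : ℂ, ‖z‖ < 1 →
      HasSum (fun n => ((n.factorial : ℂ)⁻¹ * iteratedDeriv n h 0) * z ^ n) (h z) := by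
    intro z hz
    have := Complex.hasSum_taylorSeries_on_ball (c := 0) (r := 1) (f := h)
      (by simpa using hd) (z := z) (by simpa using hz)
    simp only [sub_zero, smul_eq_mul] at this
    exact this.congr_fun fun n => by ring
  refine ⟨_, fun r hr0 hr1 => ?_, key⟩
  have := (key r (by rwa [Complex.norm_real, Real.norm_of_nonneg hr0])).summable.norm
  simpa [Real.norm_of_nonneg hr0, abs_of_nonneg hr0] using this

/-- Parseval, with `b n` the squared modulus of the Taylor coefficient. The point is that the
pairing of two dilations increases with either radius. -/
theorem exists_hasSum_inner : ∃ b : ℕ → ℝ, (∀ n, 0 ≤ b n) ∧ ∀ r s : ℝ, 0 ≤ r → r < 1 → 0 ≤ s →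
    s < 1 → HasSum (fun n => b n * (r * s) ^ n)
      (∫ ζ : Circle, conj (h (r * ζ)) * h (s * ζ) ∂arc).re := by
  obtain ⟨a, ha, hs⟩ := exists_coeff hd
  have hcoef : ∀ (m : ℕ) (r : ℝ), 0 ≤ r → r < 1 →
      ∫ ζ : Circle, conj (ζ : ℂ) ^ m * h (r * ζ) ∂arc = a m * r ^ m := by
    intro m r hr0 hr1
    have h1 := hasSum_integral_mul ha hs (continuous_conj_coe.pow m) hr0 hr1
    refine h1.unique ?_
    have h2 := hasSum_single (f := fun n => a n * (r : ℂ) ^ n *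
      ∫ ζ : Circle, conj (ζ : ℂ) ^ m * (ζ : ℂ) ^ n ∂arc) m (fun n hn => by
        rw [integral_arc_conj_pow_mul_pow, if_neg hn.symm, mul_zero])
    simpa [integral_arc_conj_pow_mul_pow] using h2
  refine ⟨fun n => ‖a n‖ ^ 2, fun n => by positivity, fun r s hr0 hr1 hs0 hs1 => ?_⟩
  have h1 := hasSum_integral_mul ha hs
    (Complex.continuous_conj.comp (continuous_dilation hd hr0 hr1)) hs0 hs1
  have h2 := Complex.hasSum_re h1
  refine h2.congr_fun fun n => ?_
  have h3 : ∫ ζ : Circle, conj (h (r * ζ)) * (ζ : ℂ) ^ n ∂arc = conj (a n * r ^ n) := by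
    rw [← hcoef n r hr0 hr1, ← integral_conj]
    congr 1; ext ζ
    simp [mul_comm]
  simp only [Function.comp_apply]
  rw [h3, ← Complex.ofReal_re (‖a n‖ ^ 2 * (r * s) ^ n)]
  congr 1
  push_cast
  rw [← Complex.conj_mul' (a n)]
  simp only [map_mul, map_pow, Complex.conj_ofReal]
  ring

/-- A function with bounded imaginary part is bounded in `L²` on circles. -/
theorem integral_norm_sq_le {C : ℝ} (hC : ∀ z : ℂ, ‖z‖ < 1 → |(h z).im| ≤ C) {r : ℝ}
    (hr0 : 0 ≤ r) (hr1 : r < 1) :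
    ∫ ζ : Circle, ‖h (r * ζ)‖ ^ 2 ∂arc ≤ (h 0 ^ 2).re + 2 * C ^ 2 := by
  have hc := continuous_dilation hd hr0 hr1
  have h1 := integral_arc_of_differentiableOn
    (g := fun w => h (r * w) ^ 2) ((differentiableOn_dilation hd hr0 hr1).pow 2)
  have h2 := integral_re (𝕜 := ℂ) (integrable_of_continuous (μ := arc) (hc.fun_pow 2))
  simp only [RCLike.re_to_complex, mul_zero] at h1 h2
  rw [← h1, ← h2]
  have i1 : Integrable (fun ζ : Circle => (h (r * ζ) ^ 2).re) arc :=
    integrable_of_continuous (Complex.continuous_re.comp (hc.pow 2))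
  -- `|h|² = Re h² + 2 (Im h)²`, and the mean value property evaluates the integral of `Re h²`.
  calc ∫ ζ : Circle, ‖h (r * ζ)‖ ^ 2 ∂arc
      ≤ ∫ ζ : Circle, ((h (r * ζ) ^ 2).re + 2 * C ^ 2) ∂arc := by
        refine integral_mono (integrable_of_continuous (hc.norm.pow 2))
          (i1.add (integrable_const _)) fun ζ => ?_
        have h3 := hC (r * ζ) (by rwa [norm_ofReal_mul_coe hr0])
        have h4 := sq_le_sq' (neg_le_of_abs_le h3) (le_of_abs_le h3)
        simp only
        rw [← Complex.normSq_eq_norm_sq, Complex.normSq_apply, sq, Complex.mul_re]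
        linarith
    _ = _ := by
        rw [integral_add i1 (integrable_const _)]
        simp

end

/-- A sequence of radii increasing to one. -/
def radius (k : ℕ) : ℝ := 1 - 1 / ((k : ℝ) + 1)

theorem radius_nonneg (k : ℕ) : 0 ≤ radius k := by
  rw [radius, sub_nonneg, div_le_one (by positivity)]
  have : (0 : ℝ) ≤ k := k.cast_nonneg
  linarith

theorem radius_lt_one (k : ℕ) : radius k < 1 := by
  rw [radius, sub_lt_self_iff]; positivity

theorem radius_mono : Monotone radius := fun j k h => by
  rw [radius, radius]
  gcongr

theorem tendsto_radius : Tendsto radius atTop (𝓝 1) := by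
  have := (tendsto_one_div_add_atTop_nhds_zero_nat (𝕜 := ℝ)).const_sub 1
  rw [sub_zero] at this
  exact this

theorem norm_radius_mul_lt_one (k : ℕ) (ζ : Circle) : ‖(radius k : ℂ) * ζ‖ < 1 := by
  rw [norm_ofReal_mul_coe (radius_nonneg k)]; exact radius_lt_one k

theorem inner_toLp {f g : Circle → ℂ} (hf : MemLp f 2 arc) (hg : MemLp g 2 arc) :
    inner ℂ (hf.toLp f) (hg.toLp g) = ∫ ζ, conj (f ζ) * g ζ ∂arc := by
  rw [L2.inner_def]
  refine integral_congr_ae ?_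
  filter_upwards [hf.coeFn_toLp, hg.coeFn_toLp] with ζ h1 h2
  rw [h1, h2, RCLike.inner_apply, mul_comm]

/-- A holomorphic function on the unit disc with bounded imaginary part has boundary values in
`L²`, and is the Schwarz integral of their real part. -/
theorem exists_boundary_values {h : ℂ → ℂ} (hd : DifferentiableOn ℂ h (Metric.ball 0 1)) {C : ℝ}
    (hC : ∀ z : ℂ, ‖z‖ < 1 → |(h z).im| ≤ C) (h0 : (h 0).im = 0) :
    ∃ H : Circle → ℂ, MemLp H 2 arc ∧
      TendstoInMeasure arc (fun k (ζ : Circle) => h (radius k * ζ)) atTop H ∧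
      ∀ z : ℂ, ‖z‖ < 1 →
        ∫ ζ : Circle, ((ζ : ℂ) + z) / ((ζ : ℂ) - z) * ((H ζ).re : ℂ) ∂arc = h z := by
  have hc : ∀ k, Continuous fun ζ : Circle => h (radius k * ζ) := fun k =>
    continuous_dilation hd (radius_nonneg k) (radius_lt_one k)
  have hm : ∀ k, MemLp (fun ζ : Circle => h (radius k * ζ)) 2 arc := fun k =>
    memLp_of_continuous (hc k)
  set v : ℕ → Lp ℂ 2 arc := fun k => (hm k).toLp _ with hv
  obtain ⟨b, hb, hsum⟩ := exists_hasSum_inner hd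
  have hin : ∀ j k, HasSum (fun n => b n * (radius j * radius k) ^ n)
      (inner ℂ (v j) (v k)).re := fun j k => by
    rw [hv, inner_toLp]
    exact hsum _ _ (radius_nonneg j) (radius_lt_one j) (radius_nonneg k) (radius_lt_one k)
  have hself : ∀ k, (inner ℂ (v k) (v k)).re = ‖v k‖ ^ 2 := fun k =>
    inner_self_eq_norm_sq (𝕜 := ℂ) (v k)
  -- The Parseval series gives `‖v j‖² ≤ Re ⟨v j, v k⟩` for `j ≤ k`, hence `‖v k - v j‖² ≤ ‖v k‖² -
  -- ‖v j‖²`. Bounded norms then force the sequence to be Cauchy.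
  have hmono : ∀ j k, j ≤ k → ‖v j‖ ^ 2 ≤ (inner ℂ (v j) (v k)).re := fun j k hjk => by
    rw [← hself]
    refine hasSum_le (fun n => ?_) (hin j j) (hin j k)
    have h1 := radius_nonneg j
    have h2 := radius_mono hjk
    have h3 := hb n
    gcongr
  have hsub : ∀ j k, j ≤ k → ‖v k - v j‖ ^ 2 ≤ ‖v k‖ ^ 2 - ‖v j‖ ^ 2 := fun j k hjk => by
    have h1 := @norm_sub_sq ℂ _ _ _ _ (v j) (v k)
    have h2 := hmono j k hjk
    rw [norm_sub_rev, h1]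
    simp only [RCLike.re_to_complex]
    linarith
  have hbdd : BddAbove (Set.range fun k => ‖v k‖ ^ 2) := by
    refine ⟨(h 0 ^ 2).re + 2 * C ^ 2, ?_⟩
    rintro _ ⟨k, rfl⟩
    refine le_trans (le_of_eq ?_)
      (integral_norm_sq_le hd hC (radius_nonneg k) (radius_lt_one k))
    simp only
    rw [← hself, hv, inner_toLp]
    have : ∫ ζ : Circle, conj (h (radius k * ζ)) * h (radius k * ζ) ∂arc =
        ((∫ ζ : Circle, ‖h (radius k * ζ)‖ ^ 2 ∂arc : ℝ) : ℂ) := by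
      rw [← integral_complex_ofReal]
      congr 1; ext ζ
      rw [Complex.conj_mul', Complex.ofReal_pow]
    rw [this, Complex.ofReal_re]
  have hcauchy : CauchySeq v := by
    rw [Metric.cauchySeq_iff']
    intro ε hε
    have hlt : (⨆ k, ‖v k‖ ^ 2) - ε ^ 2 < ⨆ k, ‖v k‖ ^ 2 := sub_lt_self _ (by positivity)
    obtain ⟨N, hN⟩ := exists_lt_of_lt_ciSup hlt
    refine ⟨N, fun n hn => ?_⟩
    rw [dist_eq_norm]
    refine lt_of_pow_lt_pow_left₀ 2 hε.le ?_
    have h1 := hsub N n hn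
    have h2 := le_ciSup hbdd n
    linarith
  obtain ⟨H, hH⟩ := cauchySeq_tendsto_of_complete hcauchy
  have hcoe : ∀ k, v k =ᵐ[arc] fun ζ : Circle => h (radius k * ζ) := fun k => (hm k).coeFn_toLp
  refine ⟨H, Lp.memLp H, (tendstoInMeasure_of_tendsto_Lp hH).congr_left hcoe, fun z hz => ?_⟩
  have hL2 : Tendsto (fun k => eLpNorm ((fun ζ : Circle => h (radius k * ζ)) - ⇑H) 2 arc) atTop
      (𝓝 0) := by
    have h1 := (Lp.tendsto_Lp_iff_tendsto_eLpNorm' v H).1 hH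
    refine h1.congr fun k => eLpNorm_congr_ae ((hcoe k).sub (ae_eq_refl _))
  set K : Circle → ℂ := fun ζ => ((ζ : ℂ) + z) / ((ζ : ℂ) - z) with hK
  have hKc : Continuous K := continuous_herglotz hz
  have hHi : Integrable (fun ζ => K ζ * ((H ζ).re : ℂ)) arc := by
    have h1 : Integrable (fun ζ => ((H ζ).re : ℂ)) arc :=
      ((Lp.memLp H).integrable one_le_two).re.ofReal
    exact h1.bdd_mul hKc.aestronglyMeasurable (Eventually.of_forall (norm_herglotz_le hz))
  have hFi : ∀ k, Continuous fun ζ : Circle => K ζ * ((h (radius k * ζ)).re : ℂ) := fun k =>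
    hKc.mul (Complex.continuous_ofReal.comp (Complex.continuous_re.comp (hc k)))
  have hlim : Tendsto (fun k => ∫ ζ : Circle, K ζ * ((h (radius k * ζ)).re : ℂ) ∂arc) atTop
      (𝓝 (∫ ζ : Circle, K ζ * ((H ζ).re : ℂ) ∂arc)) := by
    refine tendsto_integral_of_L1' _ hHi.aestronglyMeasurable (Eventually.of_forall fun k =>
      integrable_of_continuous (hFi k)) ?_
    have h2 : Tendsto (fun k => ENNReal.ofReal (2 / (1 - ‖z‖)) *
        eLpNorm ((fun ζ : Circle => h (radius k * ζ)) - ⇑H) 2 arc) atTop (𝓝 0) := by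
      simpa using ENNReal.Tendsto.const_mul hL2 (Or.inr ENNReal.ofReal_ne_top)
    refine tendsto_of_tendsto_of_tendsto_of_le_of_le tendsto_const_nhds h2 (fun _ => zero_le)
      fun k => ?_
    have hmeas : AEStronglyMeasurable ((fun ζ : Circle => h (radius k * ζ)) - ⇑H) arc :=
      (hm k).aestronglyMeasurable.sub (Lp.aestronglyMeasurable H)
    refine (eLpNorm_le_mul_eLpNorm_of_ae_le_mul (c := 2 / (1 - ‖z‖))
      (g := (fun ζ : Circle => h (radius k * ζ)) - ⇑H)
      (Eventually.of_forall fun ζ => ?_) 1).trans ?_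
    · simp only [Pi.sub_apply]
      rw [← mul_sub, ← Complex.ofReal_sub, ← Complex.sub_re, norm_mul, Complex.norm_real]
      exact mul_le_mul (norm_herglotz_le hz ζ) (Complex.abs_re_le_norm _) (norm_nonneg _)
        (div_nonneg zero_le_two (sub_pos.2 hz).le)
    · gcongr
      exact eLpNorm_le_eLpNorm_of_exponent_le one_le_two hmeas
  have hval : ∀ k, ∫ ζ : Circle, K ζ * ((h (radius k * ζ)).re : ℂ) ∂arc = h (radius k * z) :=
    fun k => integral_herglotz_mul_re
      (differentiableOn_dilation hd (radius_nonneg k) (radius_lt_one k)) (by simpa using h0) hz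
  simp_rw [hval] at hlim
  refine tendsto_nhds_unique hlim ?_
  have hcz : ContinuousAt h z := (hd.differentiableAt
    (Metric.isOpen_ball.mem_nhds (mem_ball_zero_iff.2 hz))).continuousAt
  refine hcz.tendsto.comp ?_
  have := ((Complex.continuous_ofReal.tendsto 1).comp tendsto_radius).mul_const z
  simpa using this

/-! ### The step-by-step sum rule and its iterates -/

theorem ne_zero_of_re_pos {w : ℂ} (h : 0 < w.re) : w ≠ 0 := fun h0 => by simp [h0] at h

theorem differentiableOn_log_one_sub_mul_schur (μ : Measure Circle) [IsProbabilityMeasure μ] :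
    DifferentiableOn ℂ (fun z => Complex.log (1 - z * schur μ z)) (Metric.ball 0 1) :=
  ((differentiableOn_const 1).sub (differentiableOn_id.mul (differentiableOn_schur μ))).clog
    fun _ hz => Or.inl (re_one_sub_mul_schur_pos μ (mem_ball_zero_iff.1 hz))

theorem re_one_sub_verblunsky_pos {μ : Measure Circle} [IsProbabilityMeasure μ]
    (hμ : IsNontrivial μ) {z : ℂ} (hz : ‖z‖ < 1) :
    0 < (1 - conj (verblunsky μ 0) * schur μ z).re := by
  have h1 : ‖conj (verblunsky μ 0) * schur μ z‖ < 1 := by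
    rw [norm_mul, RCLike.norm_conj]
    nlinarith [norm_schur_le_one μ hz, norm_verblunsky_lt_one hμ 0,
      norm_nonneg (verblunsky μ 0), norm_nonneg (schur μ z)]
  have := (Complex.re_le_norm _).trans_lt h1
  simpa using this

/-- A holomorphic logarithm of the relative Szegő function. -/
def logRelSzego (μ μ₁ : Measure Circle) (z : ℂ) : ℂ :=
  Complex.log (1 - conj (verblunsky μ 0) * schur μ z) + Complex.log (1 - z * schur μ₁ z) -
    Complex.log (1 - z * schur μ z) - (Real.log (rho μ 0) : ℂ)

section

variable {μ μ₁ : Measure Circle} [IsProbabilityMeasure μ] [IsProbabilityMeasure μ₁]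

theorem exp_logRelSzego (hμ : IsNontrivial μ) {z : ℂ} (hz : ‖z‖ < 1) :
    Complex.exp (logRelSzego μ μ₁ z) = relSzego μ μ₁ z := by
  rw [logRelSzego, Complex.exp_sub, Complex.exp_sub, Complex.exp_add,
    Complex.exp_log (ne_zero_of_re_pos (re_one_sub_verblunsky_pos hμ hz)),
    Complex.exp_log (one_sub_mul_schur_ne_zero μ₁ hz),
    Complex.exp_log (one_sub_mul_schur_ne_zero μ hz), ← Complex.ofReal_exp,
    Real.exp_log (rho_pos hμ 0), relSzego]
  ring

theorem differentiableOn_logRelSzego (hμ : IsNontrivial μ) :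
    DifferentiableOn ℂ (logRelSzego μ μ₁) (Metric.ball 0 1) := by
  have h1 : DifferentiableOn ℂ
      (fun z => Complex.log (1 - conj (verblunsky μ 0) * schur μ z)) (Metric.ball 0 1) :=
    ((differentiableOn_const 1).sub ((differentiableOn_const _).mul
      (differentiableOn_schur μ))).clog
      fun _ hz => Or.inl (re_one_sub_verblunsky_pos hμ (mem_ball_zero_iff.1 hz))
  exact ((h1.add (differentiableOn_log_one_sub_mul_schur μ₁)).sub
    (differentiableOn_log_one_sub_mul_schur μ)).sub_const _

omit [IsProbabilityMeasure μ] [IsProbabilityMeasure μ₁] in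
theorem abs_im_logRelSzego_le (z : ℂ) : |(logRelSzego μ μ₁ z).im| ≤ 3 * Real.pi := by
  simp only [logRelSzego, Complex.sub_im, Complex.add_im, Complex.log_im, Complex.ofReal_im]
  have h1 := abs_le.1 (Complex.abs_arg_le_pi (1 - conj (verblunsky μ 0) * schur μ z))
  have h2 := abs_le.1 (Complex.abs_arg_le_pi (1 - z * schur μ₁ z))
  have h3 := abs_le.1 (Complex.abs_arg_le_pi (1 - z * schur μ z))
  rw [abs_le]
  constructor <;> linarith [h1.1, h1.2, h2.1, h2.2, h3.1, h3.2]

/-- `f(0) = α₀` turns the first logarithm into `log ρ₀²`; subtracting `log ρ₀` leaves one copy. -/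
theorem logRelSzego_zero (hμ : IsNontrivial μ) (hμ₁ : IsNontrivial μ₁)
    (h : ∀ j, verblunsky μ₁ j = verblunsky μ (j + 1)) :
    logRelSzego μ μ₁ 0 = (Real.log (rho μ 0) : ℂ) := by
  have h1 : 1 - conj (verblunsky μ 0) * schur μ 0 = ((rho μ 0 ^ 2 : ℝ) : ℂ) := by
    rw [schur_zero hμ hμ₁ h, Complex.conj_mul', rho_sq hμ]
    push_cast; rfl
  rw [logRelSzego, h1, ← Complex.ofReal_log (sq_nonneg _), Real.log_pow]
  simp only [zero_mul, sub_zero, Complex.log_one, add_zero]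
  push_cast; ring

/-- The boundary values of the relative Szegő function. -/
theorem exists_boundary_logRelSzego (hμ : IsNontrivial μ) (hμ₁ : IsNontrivial μ₁)
    (h : ∀ j, verblunsky μ₁ j = verblunsky μ (j + 1)) :
    ∃ u : Circle → ℝ, Integrable u arc ∧
      (∀ᵐ ζ ∂arc, weight μ ζ = Real.exp (2 * u ζ) * weight μ₁ ζ) ∧
      ∀ z : ℂ, ‖z‖ < 1 →
        ∫ ζ : Circle, ((ζ : ℂ) + z) / ((ζ : ℂ) - z) * (u ζ : ℂ) ∂arc = logRelSzego μ μ₁ z := by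
  obtain ⟨H, hH2, hH, hHrep⟩ := exists_boundary_values (differentiableOn_logRelSzego hμ)
    (fun z _ => abs_im_logRelSzego_le z)
    (by rw [logRelSzego_zero hμ hμ₁ h, Complex.ofReal_im])
  -- `G` is needed only because its finiteness keeps `|1 - z f|⁻²` bounded along the radii, so that
  -- the factor `1 - r²` kills the correction term.
  obtain ⟨G, -, hG, -⟩ := exists_boundary_values (differentiableOn_log_one_sub_mul_schur μ)
    (fun z _ => by rw [Complex.log_im]; exact Complex.abs_arg_le_pi _) (by simp)
  refine ⟨fun ζ => (H ζ).re, (hH2.integrable one_le_two).re, ?_, hHrep⟩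
  have hP := tendstoInMeasure_integral_poisson radius_nonneg radius_lt_one tendsto_radius μ
  have hP₁ := tendstoInMeasure_integral_poisson radius_nonneg radius_lt_one tendsto_radius μ₁
  -- Four successive extractions turn the four convergences in measure into a.e. convergence along
  -- one common subsequence of radii.
  obtain ⟨n₁, hn₁, h₁⟩ := hH.exists_seq_tendsto_ae
  obtain ⟨n₂, hn₂, h₂⟩ := (hG.comp hn₁.tendsto_atTop).exists_seq_tendsto_ae
  have ht₂ := hn₁.tendsto_atTop.comp hn₂.tendsto_atTop
  obtain ⟨n₃, hn₃, h₃⟩ := (hP.comp ht₂).exists_seq_tendsto_ae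
  have ht₃ := ht₂.comp hn₃.tendsto_atTop
  obtain ⟨n₄, hn₄, h₄⟩ := (hP₁.comp ht₃).exists_seq_tendsto_ae
  set n : ℕ → ℕ := fun k => n₁ (n₂ (n₃ (n₄ k))) with hn
  have hnt : Tendsto n atTop atTop := ht₃.comp hn₄.tendsto_atTop
  filter_upwards [h₁, h₂, h₃, h₄] with ζ h₁ h₂ h₃ h₄
  have a₁ : Tendsto (fun k => logRelSzego μ μ₁ (radius (n k) * ζ)) atTop (𝓝 (H ζ)) :=
    h₁.comp (hn₂.tendsto_atTop.comp (hn₃.tendsto_atTop.comp hn₄.tendsto_atTop))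
  have a₂ : Tendsto (fun k => Complex.log (1 - (radius (n k) * ζ) * schur μ (radius (n k) * ζ)))
      atTop (𝓝 (G ζ)) := h₂.comp (hn₃.tendsto_atTop.comp hn₄.tendsto_atTop)
  have a₃ : Tendsto (fun k => (caratheodory μ (radius (n k) * ζ)).re) atTop (𝓝 (weight μ ζ)) :=
    (h₃.comp hn₄.tendsto_atTop).congr fun k =>
      (re_caratheodory μ (norm_radius_mul_lt_one _ ζ)).symm
  have a₄ : Tendsto (fun k => (caratheodory μ₁ (radius (n k) * ζ)).re) atTop (𝓝 (weight μ₁ ζ)) :=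
    h₄.congr fun k => (re_caratheodory μ₁ (norm_radius_mul_lt_one _ ζ)).symm
  have b₁ : Tendsto (fun k => ‖relSzego μ μ₁ (radius (n k) * ζ)‖ ^ 2) atTop
      (𝓝 (Real.exp (2 * (H ζ).re))) := by
    have := (((Complex.continuous_re.tendsto _).comp a₁).const_mul 2).rexp
    refine this.congr fun k => ?_
    rw [← exp_logRelSzego hμ (norm_radius_mul_lt_one _ ζ), Complex.norm_exp, ← Real.exp_nat_mul]
    norm_num
  have b₂ : Tendsto (fun k => (1 - ‖(radius (n k) : ℂ) * ζ‖ ^ 2) *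
      (‖schur μ ((radius (n k) : ℂ) * ζ)‖ ^ 2 /
        ‖1 - ((radius (n k) : ℂ) * ζ) * schur μ ((radius (n k) : ℂ) * ζ)‖ ^ 2)) atTop (𝓝 0) := by
    have e₁ : Tendsto (fun k => (1 - radius (n k) ^ 2) * Real.exp
        (-2 * (Complex.log (1 - ((radius (n k) : ℂ) * ζ) * schur μ ((radius (n k) : ℂ) * ζ))).re))
        atTop
        (𝓝 0) := by
      have e₂ := (((Complex.continuous_re.tendsto _).comp a₂).const_mul (-2)).rexp
      have e₃ := ((tendsto_radius.comp hnt).pow 2).const_sub 1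
      simpa using e₃.mul e₂
    refine tendsto_of_tendsto_of_tendsto_of_le_of_le tendsto_const_nhds e₁ (fun k => ?_)
      fun k => ?_
    · have := norm_radius_mul_lt_one (n k) ζ
      refine mul_nonneg ?_ (by positivity)
      nlinarith [norm_nonneg ((radius (n k) : ℂ) * ζ)]
    · have e₄ := norm_radius_mul_lt_one (n k) ζ
      have e₅ := norm_schur_le_one μ e₄
      have e₆ := one_sub_mul_schur_ne_zero μ e₄
      simp only
      rw [norm_ofReal_mul_coe (radius_nonneg _), Complex.log_re, neg_mul, Real.exp_neg,
        show ∀ x : ℝ, 2 * x = x + x from fun x => two_mul x, Real.exp_add,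
        Real.exp_log (norm_pos_iff.2 e₆), ← sq, ← one_div]
      have e₇ : 0 ≤ 1 - radius (n k) ^ 2 := by
        nlinarith [radius_nonneg (n k), radius_lt_one (n k)]
      gcongr
      nlinarith [norm_nonneg (schur μ ((radius (n k) : ℂ) * ζ))]
  have b₃ := b₁.mul a₄
  have b₄ := a₃.sub b₂
  rw [sub_zero] at b₄
  refine tendsto_nhds_unique b₄ (b₃.congr fun k => ?_)
  exact norm_relSzego_sq_mul hμ hμ₁ h (norm_radius_mul_lt_one _ ζ)

/-- The step-by-step sum rule. -/
theorem step_sum_rule (hμ : IsNontrivial μ) (hμ₁ : IsNontrivial μ₁)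
    (h : ∀ j, verblunsky μ₁ j = verblunsky μ (j + 1)) (hw : ∀ᵐ ζ ∂arc, weight μ ζ ≠ 0) :
    (∀ᵐ ζ ∂arc, weight μ₁ ζ ≠ 0) ∧
    Integrable (fun ζ => Real.log (weight μ ζ / weight μ₁ ζ)) arc ∧
    (∀ z : ℂ, ‖z‖ < 1 → relSzego μ μ₁ z =
      Complex.exp ((1 / 2) * ∫ ζ : Circle, ((ζ : ℂ) + z) / ((ζ : ℂ) - z) *
        (Real.log (weight μ ζ / weight μ₁ ζ) : ℂ) ∂arc)) ∧
    rho μ 0 ^ 2 = Real.exp (∫ ζ, Real.log (weight μ ζ / weight μ₁ ζ) ∂arc) := by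
  obtain ⟨u, hu, hwu, hrep⟩ := exists_boundary_logRelSzego hμ hμ₁ h
  -- The relation `w = e^{2u} w₁` holds without assumptions on `w`. Positivity is what allows
  -- division and identifies `2u` with the logarithm of the ratio.
  have hw₁ : ∀ᵐ ζ ∂arc, weight μ₁ ζ ≠ 0 := by
    filter_upwards [hw, hwu] with ζ h1 h2 h3
    rw [h3, mul_zero] at h2
    exact h1 h2
  have hlog : ∀ᵐ ζ ∂arc, Real.log (weight μ ζ / weight μ₁ ζ) = 2 * u ζ := by
    filter_upwards [hw₁, hwu] with ζ h1 h2
    rw [h2, mul_div_cancel_right₀ _ h1, Real.log_exp]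
  refine ⟨hw₁, (hu.const_mul 2).congr (hlog.mono fun ζ h => h.symm), fun z hz => ?_, ?_⟩
  · rw [← exp_logRelSzego hμ hz, ← hrep z hz, ← integral_const_mul]
    congr 1
    refine integral_congr_ae ?_
    filter_upwards [hlog] with ζ h1
    rw [h1]
    push_cast; ring
  · have h0 := hrep 0 (by simp)
    rw [logRelSzego_zero hμ hμ₁ h] at h0
    have h1 : ∫ ζ : Circle, ((ζ : ℂ) + 0) / ((ζ : ℂ) - 0) * (u ζ : ℂ) ∂arc =
        ((∫ ζ, u ζ ∂arc : ℝ) : ℂ) := by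
      rw [← integral_complex_ofReal]
      congr 1; ext ζ
      simp
    rw [h1] at h0
    rw [integral_congr_ae hlog, integral_const_mul, Complex.ofReal_injective h0, two_mul,
      Real.exp_add, Real.exp_log (rho_pos hμ 0), sq]

end

/-- Telescoping: `log (w / w_{n+1}) = log (w / w_n) + log (w_n / w_{n+1})` a.e., and the one-step
rule for `ν n` supplies both the last term and `w_{n+1} ≠ 0`. -/
theorem iterated_sum_rule {ν : ℕ → Measure Circle} [∀ n, IsProbabilityMeasure (ν n)]
    (hν : ∀ n, IsNontrivial (ν n)) (h : ∀ n j, verblunsky (ν n) j = verblunsky (ν 0) (j + n))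
    (hw : ∀ᵐ ζ ∂arc, weight (ν 0) ζ ≠ 0) (n : ℕ) :
    (∀ᵐ ζ ∂arc, weight (ν n) ζ ≠ 0) ∧
    Integrable (fun ζ => Real.log (weight (ν 0) ζ / weight (ν n) ζ)) arc ∧
    (∏ j ∈ Finset.range n, rho (ν 0) j) ^ 2 =
      Real.exp (∫ ζ, Real.log (weight (ν 0) ζ / weight (ν n) ζ) ∂arc) := by
  induction n with
  | zero =>
    have h0 : ∀ᵐ ζ ∂arc, Real.log (weight (ν 0) ζ / weight (ν 0) ζ) = 0 := by
      filter_upwards [hw] with ζ h1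
      rw [div_self h1, Real.log_one]
    refine ⟨hw, (integrable_zero _ _ _).congr (h0.mono fun ζ h => h.symm), ?_⟩
    rw [integral_congr_ae h0]
    simp
  | succ n ih =>
    obtain ⟨hwn, hin, hpn⟩ := ih
    obtain ⟨hw', hi', -, hp'⟩ := step_sum_rule (hν n) (hν (n + 1))
      (fun j => by rw [h (n + 1), h n]; congr 1; omega) hwn
    have hsum : ∀ᵐ ζ ∂arc, Real.log (weight (ν 0) ζ / weight (ν n) ζ) +
        Real.log (weight (ν n) ζ / weight (ν (n + 1)) ζ) =
        Real.log (weight (ν 0) ζ / weight (ν (n + 1)) ζ) := by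
      filter_upwards [hw, hwn, hw'] with ζ h0 h1 h2
      rw [Real.log_div h0 h1, Real.log_div h1 h2, Real.log_div h0 h2]
      ring
    refine ⟨hw', (hin.add hi').congr hsum, ?_⟩
    have hρ : rho (ν n) 0 = rho (ν 0) n := by rw [rho, rho, h, zero_add]
    rw [← integral_congr_ae hsum, integral_add hin hi', Real.exp_add, ← hpn, ← hp', hρ,
      Finset.prod_range_succ, mul_pow]

/-! ### Szegő's theorem: an exponential inequality for the variational infimum -/

/-- Real parts of polynomials are uniformly dense in the continuous real functions on the circle. -/
theorem exists_polynomial_re_near {g : Circle → ℝ} (hg : Continuous g) {δ : ℝ} (hδ : 0 < δ) :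
    ∃ Q : ℂ[X], ∀ ζ : Circle, |g ζ - (Q.eval (ζ : ℂ)).re| < δ := by
  have _ : Fact (0 < 2 * Real.pi) := ⟨by positivity⟩
  have hspan : ∀ p ∈ Submodule.span ℂ (Set.range (@fourier (2 * Real.pi))),
      ∃ Q₁ Q₂ : ℂ[X], ∀ x, p x = Q₁.eval (x.toCircle : ℂ) + conj (Q₂.eval (x.toCircle : ℂ)) := by
    intro p hp
    induction hp using Submodule.span_induction with
    | mem p hp =>
      obtain ⟨n, rfl⟩ := hp
      rcases n with n | n
      · refine ⟨Polynomial.X ^ n, 0, fun x => ?_⟩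
        simp [fourier_apply, AddCircle.toCircle_nsmul]
      · refine ⟨0, Polynomial.X ^ (n + 1), fun x => ?_⟩
        rw [Int.negSucc_eq, fourier_neg, ← Nat.cast_succ, fourier_apply, natCast_zsmul,
          AddCircle.toCircle_nsmul]
        simp
    | zero => exact ⟨0, 0, fun x => by simp⟩
    | add p q _ _ hp hq =>
      obtain ⟨P₁, P₂, hP⟩ := hp
      obtain ⟨Q₁, Q₂, hQ⟩ := hq
      refine ⟨P₁ + Q₁, P₂ + Q₂, fun x => ?_⟩
      simp [hP, hQ]
      ring
    | smul c p _ hp =>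
      obtain ⟨P₁, P₂, hP⟩ := hp
      refine ⟨Polynomial.C c * P₁, Polynomial.C (conj c) * P₂, fun x => ?_⟩
      simp [hP]
      ring
  set f : C(AddCircle (2 * Real.pi), ℂ) :=
    ⟨fun x => (g x.toCircle : ℂ), Complex.continuous_ofReal.comp
      (hg.comp AddCircle.continuous_toCircle)⟩ with hf
  have hmem : f ∈ (Submodule.span ℂ (Set.range (@fourier (2 * Real.pi)))).topologicalClosure := by
    rw [span_fourier_closure_eq_top]; trivial
  obtain ⟨p, hp, hpf⟩ := Metric.mem_closure_iff.1 hmem δ hδ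
  obtain ⟨Q₁, Q₂, hQ⟩ := hspan p hp
  -- Only real parts matter, and `conj Q₂` has the same real part as `Q₂`.
  refine ⟨Q₁ + Q₂, fun ζ => ?_⟩
  obtain ⟨x, rfl⟩ : ∃ x : AddCircle (2 * Real.pi), x.toCircle = ζ :=
    ⟨((ζ : ℂ).arg : ℝ), by
      rw [AddCircle.toCircle_apply_mk, div_self (by positivity), one_mul, Circle.exp_arg]⟩
  have h1 := (ContinuousMap.dist_apply_le_dist (f := f) (g := p) x).trans_lt hpf
  rw [dist_eq_norm] at h1
  refine lt_of_le_of_lt (le_of_eq_of_le ?_ (Complex.abs_re_le_norm _)) h1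
  rw [hQ, hf]
  simp

section

variable {μ : Measure Circle} [IsProbabilityMeasure μ] {L : ℝ}

/-- The test polynomials are the Taylor sums of `exp G`, which equal `1` at `0` because `G` vanishes
there. They converge boundedly on the circle, and `|exp G|² = exp (2 Re G)`. -/
theorem le_integral_exp_two_mul_re (hL : ∀ Q : ℂ[X], Q.eval 0 = 1 → L ≤ normSq μ Q) {G : ℂ[X]}
    (hG : G.eval 0 = 0) : L ≤ ∫ ζ : Circle, Real.exp (2 * (G.eval (ζ : ℂ)).re) ∂μ := by
  set E : ℕ → ℂ[X] := fun k => ∑ j ∈ Finset.range (k + 1),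
    Polynomial.C ((j.factorial : ℂ)⁻¹) * G ^ j with hE
  have hE0 : ∀ k, (E k).eval 0 = 1 := fun k => by
    simp only [hE, Polynomial.eval_finsetSum, Polynomial.eval_mul, Polynomial.eval_C,
      Polynomial.eval_pow, hG]
    rw [Finset.sum_eq_single 0] <;> simp +contextual
  have hEeval : ∀ k (ζ : Circle), (E k).eval (ζ : ℂ) =
      ∑ j ∈ Finset.range (k + 1), (j.factorial : ℂ)⁻¹ * (G.eval (ζ : ℂ)) ^ j := fun k ζ => by
    simp [hE, Polynomial.eval_finsetSum]
  have hlim : Tendsto (fun k => normSq μ (E k)) atTop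
      (𝓝 (∫ ζ : Circle, Real.exp (2 * (G.eval (ζ : ℂ)).re) ∂μ)) := by
    refine tendsto_integral_of_dominated_convergence
      (fun ζ : Circle => Real.exp ‖G.eval (ζ : ℂ)‖ ^ 2)
      (fun k => ((continuous_eval _).norm.pow 2).aestronglyMeasurable)
      (integrable_of_continuous ((Real.continuous_exp.comp (continuous_eval G).norm).pow 2))
      (fun k => Eventually.of_forall fun ζ => ?_) (Eventually.of_forall fun ζ => ?_)
    · rw [Real.norm_of_nonneg (by positivity), hEeval]
      gcongr
      refine (norm_sum_le _ _).trans (le_trans (le_of_eq ?_)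
        (Real.sum_le_exp_of_nonneg (norm_nonneg (G.eval (ζ : ℂ))) (k + 1)))
      refine Finset.sum_congr rfl fun j _ => ?_
      rw [norm_mul, norm_inv, norm_pow, Complex.norm_natCast, div_eq_inv_mul]
    · have h1 := (NormedSpace.expSeries_div_hasSum_exp (G.eval (ζ : ℂ))).tendsto_sum_nat
      rw [← Complex.exp_eq_exp_ℂ] at h1
      have h2 := ((h1.comp (tendsto_add_atTop_nat 1)).norm).pow 2
      rw [Complex.norm_exp, ← Real.exp_nat_mul] at h2
      refine h2.congr fun k => ?_
      simp only [Function.comp_apply]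
      rw [hEeval]
      simp only [div_eq_inv_mul]
  exact ge_of_tendsto' hlim fun k => hL _ (hE0 k)

/-- Approximate `g` by `Re Q` and apply the polynomial case to `G = (Q - Q(0))/2`. The subtracted
constant is the mean of `Re Q`, close to that of `g`. The loss `e^{2δ}` is one `δ` for the pointwise
error and one for the mean. -/
theorem mul_exp_integral_le_of_continuous (hL : ∀ Q : ℂ[X], Q.eval 0 = 1 → L ≤ normSq μ Q)
    {g : Circle → ℝ} (hg : Continuous g) :
    L * Real.exp (∫ ζ, g ζ ∂arc) ≤ ∫ ζ, Real.exp (g ζ) ∂μ := by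
  have key : ∀ n : ℕ, L * Real.exp (∫ ζ, g ζ ∂arc) ≤
      Real.exp (2 * (1 / ((n : ℝ) + 1))) * ∫ ζ, Real.exp (g ζ) ∂μ := by
    intro n
    set δ : ℝ := 1 / ((n : ℝ) + 1) with hδ
    obtain ⟨Q, hQ⟩ := exists_polynomial_re_near hg (δ := δ) (by positivity)
    have hQc : Continuous fun ζ : Circle => (Q.eval (ζ : ℂ)).re :=
      Complex.continuous_re.comp (continuous_eval Q)
    have hmean : ∫ ζ : Circle, (Q.eval (ζ : ℂ)).re ∂arc = (Q.eval 0).re := by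
      have h1 := integral_re (𝕜 := ℂ) (integrable_of_continuous (μ := arc) (continuous_eval Q))
      simp only [RCLike.re_to_complex] at h1
      rw [h1, integral_arc_of_differentiableOn (g := fun z => Q.eval z)
        Q.differentiable.differentiableOn]
    have hmean' : ∫ ζ, g ζ ∂arc ≤ (Q.eval 0).re + δ := by
      rw [← hmean]
      calc ∫ ζ, g ζ ∂arc ≤ ∫ ζ : Circle, ((Q.eval (ζ : ℂ)).re + δ) ∂arc := by
            refine integral_mono (integrable_of_continuous hg)
              ((integrable_of_continuous hQc).add (integrable_const δ)) fun ζ => ?_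
            have := (abs_lt.1 (hQ ζ)).2
            simp only
            linarith
        _ = _ := by
            rw [integral_add (integrable_of_continuous hQc) (integrable_const δ)]
            simp
    have h2 := le_integral_exp_two_mul_re hL
      (G := Polynomial.C (2⁻¹) * (Q - Polynomial.C (Q.eval 0))) (by simp)
    have h3 : ∫ ζ : Circle, Real.exp (2 * ((Polynomial.C (2⁻¹ : ℂ) *
        (Q - Polynomial.C (Q.eval 0))).eval (ζ : ℂ)).re) ∂μ ≤
        ∫ ζ : Circle, Real.exp (δ - (Q.eval 0).re) * Real.exp (g ζ) ∂μ := by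
      refine integral_mono (integrable_of_continuous ?_) (integrable_of_continuous ?_) fun ζ => ?_
      · exact Real.continuous_exp.comp (continuous_const.mul
          (Complex.continuous_re.comp (continuous_eval _)))
      · exact continuous_const.mul (Real.continuous_exp.comp hg)
      · simp only
        rw [← Real.exp_add]
        refine Real.exp_le_exp.2 ?_
        have h4 := (abs_lt.1 (hQ ζ)).1
        have h5 : ((2⁻¹ : ℂ) * (Q.eval (ζ : ℂ) - Q.eval 0)).re =
            2⁻¹ * ((Q.eval (ζ : ℂ)).re - (Q.eval 0).re) := by
          rw [show (2⁻¹ : ℂ) = ((2⁻¹ : ℝ) : ℂ) by push_cast; rfl, Complex.re_ofReal_mul,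
            Complex.sub_re]
        simp only [Polynomial.eval_mul, Polynomial.eval_C, Polynomial.eval_sub]
        rw [h5]
        linarith
    rw [integral_const_mul] at h3
    have h6 : 0 ≤ ∫ ζ, Real.exp (g ζ) ∂μ := integral_nonneg fun ζ => (Real.exp_pos _).le
    calc L * Real.exp (∫ ζ, g ζ ∂arc)
        ≤ Real.exp (δ - (Q.eval 0).re) * (∫ ζ, Real.exp (g ζ) ∂μ) *
          Real.exp (∫ ζ, g ζ ∂arc) := by
            gcongr
            exact h2.trans h3
      _ = Real.exp (δ - (Q.eval 0).re + ∫ ζ, g ζ ∂arc) * (∫ ζ, Real.exp (g ζ) ∂μ) := by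
            rw [Real.exp_add]; ring
      _ ≤ _ := by
            gcongr
            linarith
  have hlim : Tendsto (fun n : ℕ => Real.exp (2 * (1 / ((n : ℝ) + 1))) *
      ∫ ζ, Real.exp (g ζ) ∂μ) atTop (𝓝 (∫ ζ, Real.exp (g ζ) ∂μ)) := by
    have := (((tendsto_one_div_add_atTop_nhds_zero_nat (𝕜 := ℝ)).const_mul 2).rexp).mul_const
      (∫ ζ, Real.exp (g ζ) ∂μ)
    simpa using this
  exact ge_of_tendsto' hlim key

theorem abs_exp_sub_exp_le {a b M : ℝ} (ha : a ≤ M) (hb : b ≤ M) :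
    |Real.exp a - Real.exp b| ≤ Real.exp M * |a - b| := by
  wlog h : b ≤ a generalizing a b
  · rw [abs_sub_comm, abs_sub_comm a]
    exact this hb ha (le_of_not_ge h)
  rw [abs_of_nonneg (sub_nonneg.2 (Real.exp_le_exp.2 h)), abs_of_nonneg (sub_nonneg.2 h)]
  have h1 := Real.add_one_le_exp (b - a)
  have h2 : Real.exp b = Real.exp a * Real.exp (b - a) := by rw [← Real.exp_add]; congr 1; ring
  have h3 := Real.exp_le_exp.2 ha
  rw [h2]
  nlinarith [Real.exp_pos a]

/-- Density of continuous functions in `L¹(arc + μ)`: one approximant serves both sides, even where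
`μ` is singular. -/
theorem mul_exp_integral_le_of_bounded (hL0 : 0 ≤ L)
    (hL : ∀ Q : ℂ[X], Q.eval 0 = 1 → L ≤ normSq μ Q)
    {g : Circle → ℝ} (hg : Measurable g) {M : ℝ} (hM : ∀ ζ, |g ζ| ≤ M) :
    L * Real.exp (∫ ζ, g ζ ∂arc) ≤ ∫ ζ, Real.exp (g ζ) ∂μ := by
  have hM0 : 0 ≤ M := (abs_nonneg _).trans (hM 1)
  have hint : ∀ (ν : Measure Circle) [IsFiniteMeasure ν], Integrable g ν := fun ν _ =>
    Integrable.of_bound hg.aestronglyMeasurable M (Eventually.of_forall hM)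
  have hexp : Integrable (fun ζ => Real.exp (g ζ)) μ :=
    Integrable.of_bound (Real.measurable_exp.comp hg).aestronglyMeasurable (Real.exp M)
      (Eventually.of_forall fun ζ => by
        rw [Real.norm_of_nonneg (Real.exp_pos _).le]
        exact Real.exp_le_exp.2 (le_of_abs_le (hM ζ)))
  have key : ∀ n : ℕ, L * Real.exp (∫ ζ, g ζ ∂arc - 1 / ((n : ℝ) + 1)) ≤
      ∫ ζ, Real.exp (g ζ) ∂μ + Real.exp M * (1 / ((n : ℝ) + 1)) := by
    intro n
    set ε : ℝ := 1 / ((n : ℝ) + 1) with hε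
    obtain ⟨g₁, hg₁, -⟩ := (hint (arc + μ)).exists_boundedContinuous_integral_sub_le
      (ε := ε) (by positivity)
    -- Clamping to `[-M, M]`, where `g` already takes its values, does not increase the distance to
    -- `g`, and it bounds the Lipschitz constant of `exp` by `e^M`.
    set g₂ : Circle → ℝ := fun ζ => max (-M) (min M (g₁ ζ)) with hg₂
    have hg₂c : Continuous g₂ := continuous_const.max (continuous_const.min g₁.continuous)
    have hg₂M : ∀ ζ, g₂ ζ ≤ M := fun ζ => max_le (by linarith) (min_le_left _ _)
    have hdist : ∀ ζ, |g ζ - g₂ ζ| ≤ ‖g ζ - g₁ ζ‖ := fun ζ => by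
      have h1 : g ζ = max (-M) (min M (g ζ)) := by
        rw [min_eq_right (le_of_abs_le (hM ζ)), max_eq_right (neg_le_of_abs_le (hM ζ))]
      rw [hg₂]
      simp only
      conv_lhs => rw [h1]
      rw [max_comm (-M), max_comm (-M)]
      refine (abs_max_sub_max_le_abs (min M (g ζ)) (min M (g₁ ζ)) (-M)).trans ?_
      simpa using abs_min_sub_min_le_max M (g ζ) M (g₁ ζ)
    have hi : ∀ (ν : Measure Circle) [IsFiniteMeasure ν], Integrable (fun ζ => ‖g ζ - g₁ ζ‖) ν :=
      fun ν _ => ((hint ν).sub (integrable_of_continuous g₁.continuous)).norm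
    rw [integral_add_measure (hi arc) (hi μ)] at hg₁
    have n1 : 0 ≤ ∫ ζ, ‖g ζ - g₁ ζ‖ ∂arc := integral_nonneg fun _ => norm_nonneg _
    have n2 : 0 ≤ ∫ ζ, ‖g ζ - g₁ ζ‖ ∂μ := integral_nonneg fun _ => norm_nonneg _
    have h1 : ∫ ζ, g ζ ∂arc - ε ≤ ∫ ζ, g₂ ζ ∂arc := by
      have : ∫ ζ, g ζ ∂arc - ∫ ζ, g₂ ζ ∂arc ≤ ∫ ζ, ‖g ζ - g₁ ζ‖ ∂arc := by
        rw [← integral_sub (hint arc) (integrable_of_continuous hg₂c)]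
        exact integral_mono ((hint arc).sub (integrable_of_continuous hg₂c)) (hi arc)
          fun ζ => (le_abs_self _).trans (hdist ζ)
      linarith
    have hexp₂ : Continuous fun ζ => Real.exp (g₂ ζ) := Real.continuous_exp.comp hg₂c
    have h2 : ∫ ζ, Real.exp (g₂ ζ) ∂μ ≤ ∫ ζ, Real.exp (g ζ) ∂μ + Real.exp M * ε := by
      have : ∫ ζ, Real.exp (g₂ ζ) ∂μ - ∫ ζ, Real.exp (g ζ) ∂μ ≤
          ∫ ζ, Real.exp M * ‖g ζ - g₁ ζ‖ ∂μ := by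
        rw [← integral_sub (integrable_of_continuous hexp₂) hexp]
        refine integral_mono ((integrable_of_continuous hexp₂).sub hexp) ((hi μ).const_mul _)
          fun ζ => (le_abs_self _).trans ((abs_exp_sub_exp_le (hg₂M ζ)
            (le_of_abs_le (hM ζ))).trans ?_)
        rw [abs_sub_comm]
        exact mul_le_mul_of_nonneg_left (hdist ζ) (Real.exp_pos _).le
      rw [integral_const_mul] at this
      have h3 : Real.exp M * ∫ ζ, ‖g ζ - g₁ ζ‖ ∂μ ≤ Real.exp M * ε :=
        mul_le_mul_of_nonneg_left (by linarith) (Real.exp_pos _).le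
      linarith
    refine le_trans ?_ ((mul_exp_integral_le_of_continuous hL hg₂c).trans h2)
    exact mul_le_mul_of_nonneg_left (Real.exp_le_exp.2 h1) hL0
  have hz := tendsto_one_div_add_atTop_nhds_zero_nat (𝕜 := ℝ)
  have l1 := ((hz.const_sub (∫ ζ, g ζ ∂arc)).rexp).const_mul L
  have l2 := (hz.const_mul (Real.exp M)).const_add (∫ ζ, Real.exp (g ζ) ∂μ)
  rw [sub_zero] at l1
  rw [mul_zero, add_zero] at l2
  exact le_of_tendsto_of_tendsto' l1 l2 key

end

/-! ### The truncated weight and the logarithmic integral -/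

section

variable {μ : Measure Circle} {K L : ℝ}

theorem measurable_weight (μ : Measure Circle) : Measurable (weight μ) :=
  (Measure.measurable_rnDeriv _ _).ennreal_toReal

theorem weight_nonneg (μ : Measure Circle) (ζ : Circle) : 0 ≤ weight μ ζ := ENNReal.toReal_nonneg

/-- The weight truncated to `[K⁻¹, K]`. -/
def clampWeight (μ : Measure Circle) (K : ℝ) (ζ : Circle) : ℝ := max K⁻¹ (min (weight μ ζ) K)

theorem measurable_clampWeight (μ : Measure Circle) (K : ℝ) : Measurable (clampWeight μ K) :=
  measurable_const.max ((measurable_weight μ).min measurable_const)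

theorem clampWeight_pos (hK : 1 ≤ K) (ζ : Circle) : 0 < clampWeight μ K ζ :=
  lt_of_lt_of_le (by positivity) (le_max_left _ _)

theorem abs_log_clampWeight_le (hK : 1 ≤ K) (ζ : Circle) :
    |Real.log (clampWeight μ K ζ)| ≤ Real.log K := by
  have h1 : K⁻¹ ≤ clampWeight μ K ζ := le_max_left _ _
  have h2 : clampWeight μ K ζ ≤ K := max_le ((inv_le_one_of_one_le₀ hK).trans hK) (min_le_right _ _)
  rw [abs_le, ← Real.log_inv]
  exact ⟨Real.log_le_log (by positivity) h1, Real.log_le_log (clampWeight_pos hK ζ) h2⟩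

theorem integrable_log_clampWeight (hK : 1 ≤ K) :
    Integrable (fun ζ => Real.log (clampWeight μ K ζ)) arc :=
  Integrable.of_bound (Real.measurable_log.comp (measurable_clampWeight μ K)).aestronglyMeasurable
    (Real.log K) (Eventually.of_forall (abs_log_clampWeight_le hK))

/-- The ratio exceeds one only where the weight is cut off at `K`. As the weight has integral at
most one, that excess integrates to at most `1/K`. -/
theorem weight_div_clampWeight_le (hK : 1 ≤ K) (ζ : Circle) :
    weight μ ζ / clampWeight μ K ζ ≤ 1 + weight μ ζ / K := by
  have h0 := weight_nonneg μ ζ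
  have hK0 : 0 < K := by linarith
  rcases le_total (weight μ ζ) K with h | h
  · have h1 : weight μ ζ ≤ clampWeight μ K ζ := by
      rw [clampWeight, min_eq_left h]; exact le_max_right _ _
    have h2 := (div_le_one (clampWeight_pos hK ζ)).2 h1
    have : 0 ≤ weight μ ζ / K := by positivity
    linarith
  · have h1 : clampWeight μ K ζ = K := by
      rw [clampWeight, min_eq_right h, max_eq_right ((inv_le_one_of_one_le₀ hK).trans hK)]
    rw [h1]
    linarith

theorem logIntegral_eq_bot
    (h : ∫⁻ ζ, (-ENNReal.log (μ.rnDeriv arc ζ)).toENNReal ∂arc = ⊤) : logIntegral μ = ⊥ := by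
  rw [logIntegral, h, EReal.coe_ennreal_top, EReal.sub_top]

variable [IsProbabilityMeasure μ]

theorem integrable_mul_weight {h : Circle → ℝ} (hi : Integrable h μ) :
    Integrable (fun ζ => h ζ * weight μ ζ) arc :=
  (integrable_withDensity_iff (Measure.measurable_rnDeriv _ _) (Measure.rnDeriv_lt_top _ _)).1
    (hi.mono_measure (Measure.withDensity_rnDeriv_le μ arc))

theorem integral_eq_singularPart_add {h : Circle → ℝ} (hi : Integrable h μ) :
    ∫ ζ, h ζ ∂μ = ∫ ζ, h ζ ∂(μ.singularPart arc) + ∫ ζ, h ζ * weight μ ζ ∂arc := by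
  conv_lhs => rw [← Measure.singularPart_add_rnDeriv μ arc]
  rw [integral_add_measure (hi.mono_measure (Measure.singularPart_le μ arc))
    (hi.mono_measure (Measure.withDensity_rnDeriv_le μ arc))]
  congr 1
  rw [integral_withDensity_eq_integral_toReal_smul (Measure.measurable_rnDeriv _ _)
    (Measure.rnDeriv_lt_top _ _)]
  congr 1; ext ξ; exact mul_comm _ _

theorem integrable_weight : Integrable (weight μ) arc := Measure.integrable_toReal_rnDeriv

theorem integral_weight_le_one : ∫ ζ, weight μ ζ ∂arc ≤ 1 := by
  have h := integral_eq_singularPart_add (μ := μ) (integrable_const (1 : ℝ))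
  have h0 : 0 ≤ ∫ _ : Circle, (1 : ℝ) ∂(μ.singularPart arc) := integral_nonneg fun _ => zero_le_one
  simp only [one_mul] at h
  rw [integral_const] at h
  simp only [probReal_univ, smul_eq_mul, one_mul] at h
  linarith

/-- The exponential inequality for a test function that is minus the logarithm of the truncated
weight off the singular part and `-n` on it. The singular part contributes at most `e^{-n}`, the
absolutely continuous part at most `1 + 1/K`; then `n → ∞`. -/
theorem le_mul_exp_integral_log_clampWeight (hL0 : 0 ≤ L)
    (hL : ∀ Q : ℂ[X], Q.eval 0 = 1 → L ≤ normSq μ Q) (hK : 1 ≤ K) :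
    L ≤ (1 + 1 / K) * Real.exp (∫ ζ, Real.log (clampWeight μ K ζ) ∂arc) := by
  have hK0 : 0 < K := by linarith
  obtain ⟨s, hs, hs1, hs2⟩ := Measure.mutuallySingular_singularPart μ arc
  have key : ∀ n : ℕ, L * Real.exp (-∫ ζ, Real.log (clampWeight μ K ζ) ∂arc) ≤
      Real.exp (-n) + (1 + 1 / K) := by
    intro n
    classical
    set g : Circle → ℝ := fun ζ => if ζ ∈ s then -Real.log (clampWeight μ K ζ) else -n with hg
    have hgm : Measurable g := Measurable.ite hs
      (Real.measurable_log.comp (measurable_clampWeight μ K)).neg measurable_const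
    have hgb : ∀ ζ, |g ζ| ≤ n + Real.log K := fun ζ => by
      simp only [hg]
      have h1 := abs_log_clampWeight_le (μ := μ) hK ζ
      have h2 := Real.log_nonneg hK
      split_ifs
      · rw [abs_neg]
        have : (0 : ℝ) ≤ n := by positivity
        linarith
      · rw [abs_neg, Nat.abs_cast]; linarith
    have hsarc : ∀ᵐ ζ ∂arc, ζ ∈ s := hs2
    have hssing : ∀ᵐ ζ ∂(μ.singularPart arc), ζ ∉ s := by
      rw [ae_iff]; simpa using hs1
    have hexp : Integrable (fun ζ => Real.exp (g ζ)) μ :=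
      Integrable.of_bound (Real.measurable_exp.comp hgm).aestronglyMeasurable
        (Real.exp (n + Real.log K)) (Eventually.of_forall fun ζ => by
          rw [Real.norm_of_nonneg (Real.exp_pos _).le]
          exact Real.exp_le_exp.2 (le_of_abs_le (hgb ζ)))
    have h1 := mul_exp_integral_le_of_bounded hL0 hL hgm hgb
    have h2 : ∫ ζ, g ζ ∂arc = -∫ ζ, Real.log (clampWeight μ K ζ) ∂arc := by
      rw [← integral_neg]
      refine integral_congr_ae (hsarc.mono fun ζ h => ?_)
      simp only [hg, if_pos h]
    have h3 : ∫ ζ, Real.exp (g ζ) ∂(μ.singularPart arc) ≤ Real.exp (-n) := by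
      have h4 : ∫ ζ, Real.exp (g ζ) ∂(μ.singularPart arc) =
          ∫ _ : Circle, Real.exp (-n) ∂(μ.singularPart arc) :=
        integral_congr_ae (hssing.mono fun ζ h => by simp only [hg, if_neg h])
      rw [h4, integral_const, smul_eq_mul]
      refine mul_le_of_le_one_left (Real.exp_pos _).le ?_
      have h5 : (μ.singularPart arc) Set.univ ≤ 1 :=
        (Measure.singularPart_le μ arc Set.univ).trans_eq measure_univ
      exact ENNReal.toReal_le_of_le_ofReal zero_le_one (by simpa using h5)
    have h4 : ∫ ζ, Real.exp (g ζ) * weight μ ζ ∂arc ≤ 1 + 1 / K := by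
      have hint : Integrable (fun ζ => 1 + weight μ ζ / K) arc :=
        (integrable_const 1).add (integrable_weight.div_const K)
      calc ∫ ζ, Real.exp (g ζ) * weight μ ζ ∂arc ≤ ∫ ζ, (1 + weight μ ζ / K) ∂arc := by
            refine integral_mono_ae (integrable_mul_weight hexp) hint (hsarc.mono fun ζ h => ?_)
            simp only [hg, if_pos h]
            rw [Real.exp_neg, Real.exp_log (clampWeight_pos hK ζ), ← div_eq_inv_mul]
            exact weight_div_clampWeight_le hK ζ
        _ = 1 + (∫ ζ, weight μ ζ ∂arc) / K := by
            rw [integral_add (integrable_const 1) (integrable_weight.div_const K),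
              integral_div]
            simp
        _ ≤ 1 + 1 / K := by
            gcongr
            exact integral_weight_le_one
    rw [h2, integral_eq_singularPart_add hexp] at h1
    linarith
  have hlim : Tendsto (fun n : ℕ => Real.exp (-n) + (1 + 1 / K)) atTop (𝓝 (0 + (1 + 1 / K))) :=
    (Real.tendsto_exp_neg_atTop_nhds_zero.comp tendsto_natCast_atTop_atTop).add_const _
  have h := ge_of_tendsto' hlim key
  rw [zero_add, Real.exp_neg, ← div_eq_mul_inv, div_le_iff₀ (Real.exp_pos _)] at h
  exact h

theorem toENNReal_log_rnDeriv (μ : Measure Circle) [IsProbabilityMeasure μ] :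
    ∀ᵐ ζ ∂arc, (ENNReal.log (μ.rnDeriv arc ζ)).toENNReal =
      ENNReal.ofReal (Real.log (weight μ ζ)) := by
  filter_upwards [Measure.rnDeriv_lt_top μ arc] with ζ h
  by_cases h0 : μ.rnDeriv arc ζ = 0
  · simp [weight, h0]
  · rw [ENNReal.log_pos_real h0 h.ne, EReal.real_coe_toENNReal, weight]

/-- The case split is forced by the conventions at zero: `Real.log 0 = 0`, whereas `ENNReal.log 0 =
⊥`. Positive parts agree there, negative parts do not. -/
theorem toENNReal_neg_log_rnDeriv (μ : Measure Circle) [IsProbabilityMeasure μ] :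
    ∀ᵐ ζ ∂arc, (-ENNReal.log (μ.rnDeriv arc ζ)).toENNReal =
      if weight μ ζ = 0 then ⊤ else ENNReal.ofReal (-Real.log (weight μ ζ)) := by
  filter_upwards [Measure.rnDeriv_lt_top μ arc] with ζ h
  by_cases h0 : μ.rnDeriv arc ζ = 0
  · simp [weight, h0]
  · have h1 : weight μ ζ ≠ 0 := (ENNReal.toReal_pos h0 h.ne).ne'
    rw [ENNReal.log_pos_real h0 h.ne, if_neg h1, ← EReal.coe_neg, EReal.real_coe_toENNReal, weight]

theorem lintegral_ofReal_log_weight_ne_top (μ : Measure Circle) [IsProbabilityMeasure μ] :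
    ∫⁻ ζ, ENNReal.ofReal (Real.log (weight μ ζ)) ∂arc ≠ ⊤ := by
  refine ne_top_of_le_ne_top integrable_weight.lintegral_lt_top.ne
    (lintegral_mono (μ := arc) fun ζ => ENNReal.ofReal_le_ofReal (Real.log_le_self ?_))
  exact weight_nonneg μ ζ

theorem weight_ne_zero_of_lintegral_ne_top
    (h : ∫⁻ ζ, (-ENNReal.log (μ.rnDeriv arc ζ)).toENNReal ∂arc ≠ ⊤) :
    ∀ᵐ ζ ∂arc, weight μ ζ ≠ 0 := by
  rw [lintegral_congr_ae (toENNReal_neg_log_rnDeriv μ)] at h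
  have hm : Measurable fun ζ => if weight μ ζ = 0 then (⊤ : ℝ≥0∞) else
      ENNReal.ofReal (-Real.log (weight μ ζ)) :=
    Measurable.ite ((measurable_weight μ) (measurableSet_singleton 0)) measurable_const
      (Real.measurable_log.comp (measurable_weight μ)).neg.ennreal_ofReal
  filter_upwards [ae_lt_top hm h] with ζ h1 h2
  simp [h2] at h1

theorem integrable_log_weight
    (h : ∫⁻ ζ, (-ENNReal.log (μ.rnDeriv arc ζ)).toENNReal ∂arc ≠ ⊤) :
    Integrable (fun ζ => Real.log (weight μ ζ)) arc := by
  have hm : Measurable fun ζ => Real.log (weight μ ζ) :=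
    Real.measurable_log.comp (measurable_weight μ)
  refine ⟨hm.aestronglyMeasurable, ?_⟩
  rw [hasFiniteIntegral_iff_norm]
  have h1 : ∀ᵐ ζ ∂arc, ENNReal.ofReal ‖Real.log (weight μ ζ)‖ =
      ENNReal.ofReal (Real.log (weight μ ζ)) +
        (-ENNReal.log (μ.rnDeriv arc ζ)).toENNReal := by
    filter_upwards [weight_ne_zero_of_lintegral_ne_top h, toENNReal_neg_log_rnDeriv μ] with ζ h1 h2
    rw [h2, if_neg h1, Real.norm_eq_abs]
    rcases le_total 0 (Real.log (weight μ ζ)) with h3 | h3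
    · rw [abs_of_nonneg h3, ENNReal.ofReal_of_nonpos (p := -_) (by linarith), add_zero]
    · rw [abs_of_nonpos h3, ENNReal.ofReal_of_nonpos h3, zero_add]
  rw [lintegral_congr_ae h1, lintegral_add_left hm.ennreal_ofReal]
  exact ENNReal.add_lt_top.2 ⟨(lintegral_ofReal_log_weight_ne_top μ).lt_top, h.lt_top⟩

theorem logIntegral_eq_integral
    (h : ∫⁻ ζ, (-ENNReal.log (μ.rnDeriv arc ζ)).toENNReal ∂arc ≠ ⊤) :
    logIntegral μ = ((∫ ζ, Real.log (weight μ ζ) ∂arc : ℝ) : EReal) := by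
  have h1 : ∫⁻ ζ, (-ENNReal.log (μ.rnDeriv arc ζ)).toENNReal ∂arc =
      ∫⁻ ζ, ENNReal.ofReal (-Real.log (weight μ ζ)) ∂arc := by
    refine lintegral_congr_ae ?_
    filter_upwards [weight_ne_zero_of_lintegral_ne_top h, toENNReal_neg_log_rnDeriv μ] with ζ h1 h2
    rw [h2, if_neg h1]
  rw [integral_eq_lintegral_pos_part_sub_lintegral_neg_part (integrable_log_weight h),
    EReal.coe_sub, logIntegral, lintegral_congr_ae (toENNReal_log_rnDeriv μ), ← h1,
    EReal.coe_ennreal_toReal h, EReal.coe_ennreal_toReal (lintegral_ofReal_log_weight_ne_top μ)]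

end

section

variable {μ : Measure Circle} {L : ℝ}

theorem clampWeight_eventually_eq {ζ : Circle} (h : weight μ ζ ≠ 0) :
    ∀ᶠ n : ℕ in atTop, clampWeight μ (n + 1) ζ = weight μ ζ := by
  have h0 : 0 < weight μ ζ := lt_of_le_of_ne (weight_nonneg μ ζ) h.symm
  filter_upwards [tendsto_natCast_atTop_atTop.eventually_ge_atTop (weight μ ζ),
    tendsto_natCast_atTop_atTop.eventually_ge_atTop (weight μ ζ)⁻¹] with n h1 h2
  rw [clampWeight, min_eq_left (by linarith), max_eq_right]
  exact inv_le_of_inv_le₀ h0 (by linarith)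

theorem abs_log_clampWeight_le_abs_log {K : ℝ} (hK : 1 ≤ K) {ζ : Circle} (h : weight μ ζ ≠ 0) :
    |Real.log (clampWeight μ K ζ)| ≤ |Real.log (weight μ ζ)| := by
  have h0 : 0 < weight μ ζ := lt_of_le_of_ne (weight_nonneg μ ζ) h.symm
  have hKi : K⁻¹ ≤ 1 := inv_le_one_of_one_le₀ hK
  rcases le_total 1 (weight μ ζ) with h1 | h1
  · have h2 : 1 ≤ clampWeight μ K ζ := (le_min h1 hK).trans (le_max_right _ _)
    have h3 : clampWeight μ K ζ ≤ weight μ ζ := max_le (by linarith) (min_le_left _ _)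
    rw [abs_of_nonneg (Real.log_nonneg h2), abs_of_nonneg (Real.log_nonneg h1)]
    exact Real.log_le_log (by linarith) h3
  · have h2 : clampWeight μ K ζ ≤ 1 := max_le hKi ((min_le_left _ _).trans h1)
    have h3 : weight μ ζ ≤ clampWeight μ K ζ := by
      rw [clampWeight, min_eq_left (h1.trans hK)]; exact le_max_right _ _
    rw [abs_of_nonpos (Real.log_nonpos (by linarith) h2),
      abs_of_nonpos (Real.log_nonpos h0.le h1)]
    exact neg_le_neg (Real.log_le_log h0 h3)

theorem max_log_clampWeight_le {K : ℝ} (hK : 1 ≤ K) (ζ : Circle) :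
    max (Real.log (clampWeight μ K ζ)) 0 ≤ weight μ ζ := by
  have h0 := weight_nonneg μ ζ
  refine max_le ?_ h0
  have hKi : K⁻¹ ≤ 1 := inv_le_one_of_one_le₀ hK
  have h1 : clampWeight μ K ζ ≤ weight μ ζ + 1 :=
    max_le (by linarith) ((min_le_left _ _).trans (by linarith))
  have := Real.log_le_sub_one_of_pos (clampWeight_pos (μ := μ) hK ζ)
  linarith

variable [IsProbabilityMeasure μ]

/-- Fatou's lemma for the negative parts of the truncated logarithms. A positive infimum bounds
their integrals uniformly, so it also excludes zeros of the weight on a set of positive measure. -/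
theorem lintegral_neg_log_ne_top (hL0 : 0 < L)
    (hL : ∀ Q : ℂ[X], Q.eval 0 = 1 → L ≤ normSq μ Q) :
    ∫⁻ ζ, (-ENNReal.log (μ.rnDeriv arc ζ)).toENNReal ∂arc ≠ ⊤ := by
  set c : ℕ → Circle → ℝ := fun n => clampWeight μ ((n : ℝ) + 1) with hc
  have h1n : ∀ n : ℕ, (1 : ℝ) ≤ (n : ℝ) + 1 := fun n => by
    have : (0 : ℝ) ≤ n := n.cast_nonneg
    linarith
  have hm : ∀ n, Measurable fun ζ => ENNReal.ofReal (-Real.log (c n ζ)) := fun n =>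
    (Real.measurable_log.comp (measurable_clampWeight μ _)).neg.ennreal_ofReal
  have hlim : ∀ᵐ ζ ∂arc, (-ENNReal.log (μ.rnDeriv arc ζ)).toENNReal =
      liminf (fun n => ENNReal.ofReal (-Real.log (c n ζ))) atTop := by
    filter_upwards [toENNReal_neg_log_rnDeriv μ] with ζ h
    rw [h]
    refine (Tendsto.liminf_eq ?_).symm
    split_ifs with h0
    · refine ENNReal.tendsto_ofReal_atTop.comp ?_
      refine (Real.tendsto_log_atTop.comp (tendsto_atTop_add_const_right atTop (1 : ℝ)
        tendsto_natCast_atTop_atTop)).congr fun n => ?_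
      have : (0 : ℝ) < (n : ℝ) + 1 := by linarith [h1n n]
      simp only [hc, clampWeight, h0, Function.comp_apply]
      rw [min_eq_left this.le, max_eq_left (by positivity), Real.log_inv, neg_neg]
    · exact tendsto_const_nhds.congr' ((clampWeight_eventually_eq h0).mono fun n hn => by
        simp only [hc, hn])
  -- The integral of the positive part is at most `1`, and `∫ log c_n ≥ log L - log (1 + 1/(n+1)) ≥
  -- log L - 1`. The difference is the bound `2 - log L`.
  have hbound : ∀ n, ∫⁻ ζ, ENNReal.ofReal (-Real.log (c n ζ)) ∂arc ≤
      ENNReal.ofReal (2 - Real.log L) := by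
    intro n
    have hi : Integrable (fun ζ => Real.log (c n ζ)) arc := integrable_log_clampWeight (h1n n)
    have hneg : Integrable (fun ζ => max (-Real.log (c n ζ)) 0) arc := hi.neg.pos_part
    have hpos : Integrable (fun ζ => max (Real.log (c n ζ)) 0) arc := hi.pos_part
    have e1 : ∫ ζ, max (-Real.log (c n ζ)) 0 ∂arc =
        ∫ ζ, max (Real.log (c n ζ)) 0 ∂arc - ∫ ζ, Real.log (c n ζ) ∂arc := by
      rw [← integral_sub hpos hi]
      congr 1; ext ζ
      rcases le_total 0 (Real.log (c n ζ)) with h | h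
      · rw [max_eq_left h, max_eq_right (by linarith), sub_self]
      · rw [max_eq_right h, max_eq_left (by linarith), zero_sub]
    have e2 : ∫ ζ, max (Real.log (c n ζ)) 0 ∂arc ≤ 1 :=
      (integral_mono hpos integrable_weight (max_log_clampWeight_le (h1n n))).trans
        integral_weight_le_one
    have e3 : Real.log L - 1 ≤ ∫ ζ, Real.log (c n ζ) ∂arc := by
      have h := le_mul_exp_integral_log_clampWeight hL0.le hL (h1n n)
      have h3 : (0 : ℝ) < 1 / ((n : ℝ) + 1) := by have := h1n n; positivity
      have h4 : 1 / ((n : ℝ) + 1) ≤ 1 := (div_le_one (by linarith [h1n n])).2 (h1n n)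
      have h5 := Real.log_le_log hL0 h
      rw [Real.log_mul (by linarith) (Real.exp_pos _).ne', Real.log_exp] at h5
      have h6 := Real.log_le_sub_one_of_pos (x := 1 + 1 / ((n : ℝ) + 1)) (by linarith)
      simp only [hc]
      linarith
    calc ∫⁻ ζ, ENNReal.ofReal (-Real.log (c n ζ)) ∂arc
        = ∫⁻ ζ, ENNReal.ofReal (max (-Real.log (c n ζ)) 0) ∂arc := by simp
      _ = ENNReal.ofReal (∫ ζ, max (-Real.log (c n ζ)) 0 ∂arc) :=
          (ofReal_integral_eq_lintegral_ofReal hneg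
            (Eventually.of_forall fun ζ => le_max_right _ _)).symm
      _ ≤ _ := ENNReal.ofReal_le_ofReal (by linarith)
  rw [lintegral_congr_ae hlim]
  refine ne_top_of_le_ne_top ENNReal.ofReal_ne_top ((lintegral_liminf_le hm).trans
    ((liminf_le_liminf (Eventually.of_forall hbound)).trans_eq (liminf_const _)))

/-- Let `K = n + 1` tend to infinity. Truncation to `[K⁻¹, K]` shrinks `|log w|`, so dominated
convergence applies. -/
theorem le_exp_integral_log_weight (hL0 : 0 ≤ L)
    (hL : ∀ Q : ℂ[X], Q.eval 0 = 1 → L ≤ normSq μ Q)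
    (h : ∫⁻ ζ, (-ENNReal.log (μ.rnDeriv arc ζ)).toENNReal ∂arc ≠ ⊤) :
    L ≤ Real.exp (∫ ζ, Real.log (weight μ ζ) ∂arc) := by
  have h1n : ∀ n : ℕ, (1 : ℝ) ≤ (n : ℝ) + 1 := fun n => by
    have : (0 : ℝ) ≤ n := n.cast_nonneg
    linarith
  have hw := weight_ne_zero_of_lintegral_ne_top h
  have hlim : Tendsto (fun n : ℕ => ∫ ζ, Real.log (clampWeight μ ((n : ℝ) + 1) ζ) ∂arc) atTop
      (𝓝 (∫ ζ, Real.log (weight μ ζ) ∂arc)) := by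
    refine tendsto_integral_of_dominated_convergence (fun ζ => |Real.log (weight μ ζ)|)
      (fun n => (integrable_log_clampWeight (h1n n)).aestronglyMeasurable)
      (integrable_log_weight h).abs (fun n => ?_) ?_
    · exact hw.mono fun ζ hζ => abs_log_clampWeight_le_abs_log (h1n n) hζ
    · exact hw.mono fun ζ hζ => tendsto_const_nhds.congr'
        ((clampWeight_eventually_eq hζ).mono fun n hn => by simp only [hn])
  have hlim' := ((tendsto_one_div_add_atTop_nhds_zero_nat (𝕜 := ℝ)).const_add 1).mul hlim.rexp
  rw [add_zero, one_mul] at hlim'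
  exact ge_of_tendsto' hlim' fun n => le_mul_exp_integral_log_clampWeight hL0 hL (h1n n)

theorem ofReal_le_exp_logIntegral (hL : ∀ Q : ℂ[X], Q.eval 0 = 1 → L ≤ normSq μ Q) :
    ENNReal.ofReal L ≤ EReal.exp (logIntegral μ) := by
  rcases le_or_gt L 0 with h0 | h0
  · rw [ENNReal.ofReal_of_nonpos h0]; exact zero_le
  · have h := lintegral_neg_log_ne_top h0 hL
    rw [logIntegral_eq_integral h, EReal.exp_coe]
    exact ENNReal.ofReal_le_ofReal (le_exp_integral_log_weight h0.le hL h)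

/-! ### Szegő's theorem: the Jensen bound and the conclusion -/

theorem arc_singleton (ξ : Circle) : arc {ξ} = 0 := by
  have hc : (Circle.exp ⁻¹' {ξ}).Countable := by
    refine (Set.countable_range fun m : ℤ => (ξ : ℂ).arg + m * (2 * Real.pi)).mono fun t ht => ?_
    have h1 : Circle.exp t = Circle.exp (ξ : ℂ).arg := by rw [Circle.exp_arg]; exact ht
    obtain ⟨m, hm⟩ := Circle.exp_eq_exp.1 h1
    exact ⟨m, hm.symm⟩
  rw [arc, Measure.smul_apply, Measure.map_apply Circle.exp.continuous.measurable
    (measurableSet_singleton ξ), hc.measure_zero, smul_zero]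

theorem ae_eval_ne_zero {P : ℂ[X]} (hP : P ≠ 0) : ∀ᵐ ζ : Circle ∂arc, P.eval (ζ : ℂ) ≠ 0 := by
  have hfin : {ζ : Circle | P.eval (ζ : ℂ) = 0}.Finite := by
    refine Set.Finite.of_finite_image ((P.rootSet_finite ℂ).subset ?_)
      Subtype.coe_injective.injOn
    rintro _ ⟨ζ, hζ, rfl⟩
    rw [Polynomial.mem_rootSet]
    exact ⟨hP, by simpa using hζ⟩
  rw [ae_iff]
  simp only [not_not]
  have : NullSingletonClass arc := ⟨arc_singleton⟩
  exact hfin.measure_zero arc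

theorem stronglyMeasurable_log_norm_eval (P : ℂ[X]) :
    StronglyMeasurable fun ζ : Circle => Real.log ‖P.eval (ζ : ℂ)‖ :=
  (Real.measurable_log.comp (continuous_eval P).norm.measurable).stronglyMeasurable

theorem integrable_log_norm_eval (P : ℂ[X]) :
    Integrable (fun ζ : Circle => Real.log ‖P.eval (ζ : ℂ)‖) arc := by
  rw [integrable_arc_iff (stronglyMeasurable_log_norm_eval P)]
  have := P.intervalIntegrable_mahlerMeasure
  simpa [Function.comp_def, circleMap] using this

/-- The integral is the logarithmic Mahler measure of `P`, nonnegative for a monic polynomial. -/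
theorem integral_log_norm_eval_nonneg {P : ℂ[X]} (hP : P.Monic) :
    0 ≤ ∫ ζ : Circle, Real.log ‖P.eval (ζ : ℂ)‖ ∂arc := by
  have h := integral_arc_eq_circleAverage (g := fun z => Real.log ‖P.eval z‖) (r := 1)
    (by simpa only [Complex.ofReal_one, one_mul] using stronglyMeasurable_log_norm_eval P)
  simp only [Complex.ofReal_one, one_mul] at h
  rw [h, ← Polynomial.logMahlerMeasure_def, Polynomial.logMahlerMeasure_eq_log_MahlerMeasure]
  exact Real.log_nonneg (Polynomial.one_le_mahlerMeasure_of_one_le_norm_leadingCoeff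
    (by rw [hP.leadingCoeff, norm_one]))

/-- Jensen's inequality for `exp` gives `exp ∫ log (|P|² w) ≤ ∫ |P|² w`. Dropping `2 ∫ log |P| ≥ 0`
on the left and adding the singular part on the right only weakens it. -/
theorem exp_logIntegral_le_normSq {P : ℂ[X]} (hP : P.Monic) :
    EReal.exp (logIntegral μ) ≤ ENNReal.ofReal (normSq μ P) := by
  by_cases h : ∫⁻ ζ, (-ENNReal.log (μ.rnDeriv arc ζ)).toENNReal ∂arc = ⊤
  · rw [logIntegral_eq_bot h, EReal.exp_bot]; exact zero_le
  rw [logIntegral_eq_integral h, EReal.exp_coe]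
  refine ENNReal.ofReal_le_ofReal ?_
  have hlw := integrable_log_weight h
  have hlP := (integrable_log_norm_eval P).const_mul 2
  set y : Circle → ℝ := fun ζ => 2 * Real.log ‖P.eval (ζ : ℂ)‖ + Real.log (weight μ ζ) with hy
  have hyi : Integrable y arc := hlP.add hlw
  have hPi : Integrable (fun ζ : Circle => ‖P.eval (ζ : ℂ)‖ ^ 2) μ :=
    integrable_of_continuous ((continuous_eval P).norm.pow 2)
  have hexp : ∀ᵐ ζ : Circle ∂arc, ‖P.eval (ζ : ℂ)‖ ^ 2 * weight μ ζ = Real.exp (y ζ) := by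
    filter_upwards [weight_ne_zero_of_lintegral_ne_top h, ae_eval_ne_zero hP.ne_zero] with ζ h1 h2
    simp only [hy]
    rw [Real.exp_add, Real.exp_log (lt_of_le_of_ne (weight_nonneg μ ζ) h1.symm), two_mul,
      Real.exp_add, Real.exp_log (norm_pos_iff.2 h2), sq]
  have hexpi : Integrable (fun ζ => Real.exp (y ζ)) arc := (integrable_mul_weight hPi).congr hexp
  calc Real.exp (∫ ζ, Real.log (weight μ ζ) ∂arc) ≤ Real.exp (∫ ζ, y ζ ∂arc) := by
        refine Real.exp_le_exp.2 ?_
        rw [hy, integral_add hlP hlw, integral_const_mul]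
        linarith [integral_log_norm_eval_nonneg hP]
    _ ≤ ∫ ζ, Real.exp (y ζ) ∂arc :=
        convexOn_exp.map_integral_le Real.continuous_exp.continuousOn isClosed_univ
          (Eventually.of_forall fun _ => Set.mem_univ _) hyi hexpi
    _ = ∫ ζ : Circle, ‖P.eval (ζ : ℂ)‖ ^ 2 * weight μ ζ ∂arc := (integral_congr_ae hexp).symm
    _ ≤ normSq μ P := by
        rw [normSq, integral_eq_singularPart_add hPi]
        exact le_add_of_nonneg_left (integral_nonneg fun _ => by positivity)

/-- The partial products are `‖Φ_n‖²`, which decrease to their infimum. By minimality of `Φ_n^*`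
this infimum is admissible as `L`, while each `Φ_n`, being monic, obeys the Jensen bound. -/
theorem tendsto_prod_one_sub_normSq_verblunsky (hμ : IsNontrivial μ) :
    Tendsto (fun n : ℕ => ENNReal.ofReal (∏ j ∈ Finset.range n, (1 - ‖verblunsky μ j‖ ^ 2)))
      atTop (𝓝 (EReal.exp (logIntegral μ))) := by
  simp only [← normSq_monicOP_eq_prod hμ]
  have hanti : Antitone fun n => normSq μ (monicOP μ n) := antitone_nat_of_succ_le fun n => by
    rw [normSq_monicOP_succ hμ]
    nlinarith [normSq_nonneg μ (monicOP μ n), sq_nonneg ‖verblunsky μ n‖]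
  have hbdd : BddBelow (Set.range fun n => normSq μ (monicOP μ n)) :=
    ⟨0, by rintro _ ⟨n, rfl⟩; exact normSq_nonneg μ _⟩
  have hlim := tendsto_atTop_ciInf hanti hbdd
  have hlim' := (ENNReal.continuous_ofReal.tendsto _).comp hlim
  have hle : ∀ Q : ℂ[X], Q.eval 0 = 1 → ⨅ n, normSq μ (monicOP μ n) ≤ normSq μ Q := fun Q hQ =>
    (ciInf_le hbdd Q.natDegree).trans (normSq_le_of_eval_zero_eq_one hμ le_rfl hQ)
  rw [le_antisymm (ge_of_tendsto' hlim' fun n => exp_logIntegral_le_normSq (monicOP_monic μ n))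
    (ofReal_le_exp_logIntegral hle)]
  exact hlim'

end

end OPUC

end

theorem mainTheorem2 (μ : Measure Circle) [IsProbabilityMeasure μ] (hμ : OPUC.IsNontrivial μ) :
    -- the step-by-step sum rule
    ((∀ᵐ ζ ∂OPUC.arc, OPUC.weight μ ζ ≠ 0) →
      ∀ μ₁ : Measure Circle, IsProbabilityMeasure μ₁ → OPUC.IsNontrivial μ₁ →
        (∀ j, OPUC.verblunsky μ₁ j = OPUC.verblunsky μ (j + 1)) →
        (∀ᵐ ζ ∂OPUC.arc, OPUC.weight μ₁ ζ ≠ 0) ∧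
        Integrable (fun ζ => Real.log (OPUC.weight μ ζ / OPUC.weight μ₁ ζ)) OPUC.arc ∧
        (∀ z : ℂ, ‖z‖ < 1 →
          OPUC.relSzego μ μ₁ z =
            Complex.exp ((1 / 2) * ∫ ζ : Circle, ((ζ : ℂ) + z) / ((ζ : ℂ) - z) *
              (Real.log (OPUC.weight μ ζ / OPUC.weight μ₁ ζ) : ℂ) ∂OPUC.arc)) ∧
        OPUC.rho μ 0 ^ 2 =
          Real.exp (∫ ζ, Real.log (OPUC.weight μ ζ / OPUC.weight μ₁ ζ) ∂OPUC.arc)) ∧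
    -- its iterates
    ((∀ᵐ ζ ∂OPUC.arc, OPUC.weight μ ζ ≠ 0) →
      ∀ ν : ℕ → Measure Circle, ν 0 = μ → (∀ n, IsProbabilityMeasure (ν n)) →
        (∀ n, OPUC.IsNontrivial (ν n)) →
        (∀ n j, OPUC.verblunsky (ν n) j = OPUC.verblunsky μ (j + n)) →
        ∀ n : ℕ, (∀ᵐ ζ ∂OPUC.arc, OPUC.weight (ν n) ζ ≠ 0) ∧
          Integrable (fun ζ => Real.log (OPUC.weight μ ζ / OPUC.weight (ν n) ζ)) OPUC.arc ∧
          (∏ j ∈ Finset.range n, OPUC.rho μ j) ^ 2 =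
            Real.exp (∫ ζ, Real.log (OPUC.weight μ ζ / OPUC.weight (ν n) ζ) ∂OPUC.arc)) ∧
    -- Szegő's theorem, where the logarithmic integral may be `-∞`
    Tendsto (fun n : ℕ => ENNReal.ofReal (∏ j ∈ Finset.range n, (1 - ‖OPUC.verblunsky μ j‖ ^ 2)))
      atTop (𝓝 (EReal.exp (OPUC.logIntegral μ))) := by
  refine ⟨fun hw μ₁ hP hμ₁ h => OPUC.step_sum_rule hμ hμ₁ h hw, ?_,
    OPUC.tendsto_prod_one_sub_normSq_verblunsky hμ⟩
  rintro hw ν rfl hP hν h n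
  exact OPUC.iterated_sum_rule hν h hw n
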